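/- Fix an integer $m\ge 1$, real numbers $\gamma_1,\gamma_2,K>0$ and $0<\delta<7/2$. Let $N\ge 16$ be an integer. Let $c_1(p),\dots,c_m(p)$ ($p$ prime) be complex numbers with $|c_j(p)|\le 1$, and let $L(s)$ be given for $\Re s>1$ by $$L(s)=\prod_{p}\prod_{j=1}^m\bigl(1-c_j(p)p^{-s}\bigr)^{-1}.$$ Write $s=\sigma+it$, and assume that for some $\sigma_L$ with $1/2\le\sigma_L<1$ and $\delta<7(1-\sigma_L)$: (1) $L(s)$ continues analytically to a holomorphic function for $\sigma\ge\sigma_L$; (2) $L(s)$ has no zero in $$D_{\delta,N}=\{\sigma\ge 1\}\cup\{1-\delta/7\le\sigma<1,\ |t|\le 2(\log N)^3\};$$ (3) $|L(s)|\le K N^{\gamma_1}(1+|t|)^{\gamma_2}$ for $\sigma_L<\sigma<4$. Then there is a logarithm $\log L(s)$ of $L(s)$, holomorphic on $D_{\delta,N}$, with $\log L(s)=-\sum_p\sum_{j=1}^m\log(1-c_j(p)p^{-s})$ (principal logarithms) for $\sigma>1$, and for this logarithm $$\log L(1)=\sum_{p\le(\log N)^{14/\delta}}\frac{d_p(1)}{p}+C(1)+O_{\delta}\Bigl(\frac{1}{\log\log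 N}\Bigr),$$ where $$d_p(\ell)=\sum_{j=1}^m c_j(p)^\ell,\qquad C(1)=\sum_p\sum_{\ell=2}^\infty\frac{d_p(\ell)}{\ell p^{\ell}},$$ and the implied constant depends only on $\delta$, $m$, $\gamma_1$, $\gamma_2$ and $K$ (not on $N$, the $c_j(p)$, $L$ or $\sigma_L$). -/

import Mathlib

namespace GeneralL

/-- `d_p(ℓ) = ∑_j c_j(p)^ℓ`, for a family of local parameters `c j p = c_j(p)`. -/
noncomputable def powerSum {m : ℕ} (c : Fin m → ℕ → ℂ) (p ℓ : ℕ) : ℂ :=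
  ∑ j, c j p ^ ℓ

/-- `L` is the `L`-function with local parameters `c`: `|c_j(p)| ≤ 1` at all primes, and
`L(s) = ∏_p ∏_j (1 - c_j(p) p^{-s})⁻¹` for `Re s > 1`. -/
structure IsEulerProduct {m : ℕ} (c : Fin m → ℕ → ℂ) (L : ℂ → ℂ) : Prop where
  norm_le_one : ∀ j p, p.Prime → ‖c j p‖ ≤ 1
  hasProd : ∀ s : ℂ, 1 < s.re →
    HasProd (fun p : Nat.Primes => ∏ j, (1 - c j p * (p : ℂ) ^ (-s))⁻¹) (L s)

/-- `L` is holomorphic for `σ ≥ σL`, that is, on a neighbourhood of that closed half-plane. -/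
def HolomorphicFrom (L : ℂ → ℂ) (σL : ℝ) : Prop :=
  AnalyticOnNhd ℂ L {s : ℂ | σL ≤ s.re}

/-- The region `D_{δ,N}`: the half-plane `σ ≥ 1` together with the rectangle
`1 - δ/7 ≤ σ < 1`, `|t| ≤ 2 (log N)^3`. -/
def region (δ : ℝ) (N : ℕ) : Set ℂ :=
  {s : ℂ | 1 ≤ s.re} ∪
    {s : ℂ | 1 - δ / 7 ≤ s.re ∧ s.re < 1 ∧ |s.im| ≤ 2 * Real.log N ^ 3}

/-- `L` has no zero in `D_{δ,N}`. -/
def ZeroFree (L : ℂ → ℂ) (δ : ℝ) (N : ℕ) : Prop :=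
  ∀ s ∈ region δ N, L s ≠ 0

/-- `|L(s)| ≤ K N^{γ₁} (1 + |t|)^{γ₂}` for `σL < σ < 4`. -/
def GrowthBound (L : ℂ → ℂ) (N : ℕ) (σL γ₁ γ₂ K : ℝ) : Prop :=
  ∀ s : ℂ, σL < s.re → s.re < 4 → ‖L s‖ ≤ K * (N : ℝ) ^ γ₁ * (1 + |s.im|) ^ γ₂

/-- `logL` is the logarithm of `L` on `D_{δ,N}`: it is holomorphic on `D_{δ,N}`, it satisfies
`exp (logL s) = L s` there, and for `Re s > 1` it is given by
`-∑_p ∑_j log (1 - c_j(p) p^{-s})` with the principal logarithm. -/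
structure IsLogOf {m : ℕ} (c : Fin m → ℕ → ℂ) (L : ℂ → ℂ) (δ : ℝ) (N : ℕ)
    (logL : ℂ → ℂ) : Prop where
  analytic : AnalyticOnNhd ℂ logL (region δ N)
  exp_eq : ∀ s ∈ region δ N, Complex.exp (logL s) = L s
  hasSum : ∀ s : ℂ, 1 < s.re →
    HasSum (fun p : Nat.Primes => -∑ j, Complex.log (1 - c j p * (p : ℂ) ^ (-s))) (logL s)

/-- The term `d_p(ℓ) / (ℓ p^{ℓα})`. -/
noncomputable def primePowerTerm {m : ℕ} (c : Fin m → ℕ → ℂ) (α : ℝ) (p ℓ : ℕ) : ℂ :=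
  powerSum c p ℓ / ((ℓ : ℂ) * (((p : ℝ) ^ ((ℓ : ℝ) * α) : ℝ) : ℂ))

/-- `C(α) = ∑_p ∑_{ℓ ≥ 2} d_p(ℓ) / (ℓ p^{ℓα})`, for `α > 1/2`; the index is `ℓ = k + 2`. -/
noncomputable def higherSum {m : ℕ} (c : Fin m → ℕ → ℂ) (α : ℝ) : ℂ :=
  ∑' p : Nat.Primes, ∑' k : ℕ, primePowerTerm c α p (k + 2)

/-- The double series that defines `C(α)` converges absolutely. -/
theorem summable_primePowerTerm {m : ℕ} (c : Fin m → ℕ → ℂ)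
    (hc : ∀ j p, p.Prime → ‖c j p‖ ≤ 1) (α : ℝ) (hα : 1 / 2 < α) :
    Summable (fun x : Nat.Primes × ℕ => primePowerTerm c α x.1 (x.2 + 2)) := by
  have h1 : Summable (fun p : Nat.Primes => (m : ℝ) * (p : ℝ) ^ (-(2 * α))) :=
    (Nat.Primes.summable_rpow.mpr (by linarith)).mul_left _
  have hr : (2 : ℝ) ^ (-α) < 1 :=
    Real.rpow_lt_one_of_one_lt_of_neg (by norm_num) (by linarith)
  have h2 : Summable (fun k : ℕ => ((2 : ℝ) ^ (-α)) ^ k) :=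
    summable_geometric_of_lt_one (by positivity) hr
  have h3 := h1.mul_of_nonneg h2 (fun p => by positivity) (fun k => by positivity)
  refine Summable.of_norm_bounded h3 ?_
  rintro ⟨p, k⟩
  have hp : (2 : ℝ) ≤ (p : ℕ) := by exact_mod_cast p.2.two_le
  have hp0 : (0 : ℝ) < (p : ℕ) := by linarith
  have hd : ‖powerSum c p (k + 2)‖ ≤ m := by
    unfold powerSum
    calc ‖∑ j, c j p ^ (k + 2)‖ ≤ ∑ j : Fin m, (1 : ℝ) :=
          norm_sum_le_of_le _ (fun j _ => by
            rw [norm_pow]; exact pow_le_one₀ (norm_nonneg _) (hc j p p.2))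
      _ = m := by simp
  have hsplit : ((p : ℕ) : ℝ) ^ (((k + 2 : ℕ) : ℝ) * α)
      = ((p : ℕ) : ℝ) ^ (2 * α) * (((p : ℕ) : ℝ) ^ α) ^ k := by
    rw [← Real.rpow_mul_natCast hp0.le, ← Real.rpow_add hp0]
    congr 1
    push_cast
    ring
  have hle : (2 : ℝ) ^ α ≤ ((p : ℕ) : ℝ) ^ α :=
    Real.rpow_le_rpow (by norm_num) hp (by linarith)
  have h2α : (0 : ℝ) < (2 : ℝ) ^ α := by positivity
  have hpα : (0 : ℝ) < ((p : ℕ) : ℝ) ^ (2 * α) := by positivity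
  have hk : (1 : ℝ) ≤ ((k + 2 : ℕ) : ℝ) := by push_cast; linarith [(Nat.cast_nonneg k : (0 : ℝ) ≤ k)]
  have hden : ((p : ℕ) : ℝ) ^ (2 * α) * ((2 : ℝ) ^ α) ^ k
      ≤ ((k + 2 : ℕ) : ℝ) * ((p : ℕ) : ℝ) ^ (((k + 2 : ℕ) : ℝ) * α) := by
    rw [hsplit]
    have : ((p : ℕ) : ℝ) ^ (2 * α) * ((2 : ℝ) ^ α) ^ k
        ≤ ((p : ℕ) : ℝ) ^ (2 * α) * (((p : ℕ) : ℝ) ^ α) ^ k := by gcongr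
    refine this.trans (le_mul_of_one_le_left (by positivity) hk)
  have hnorm : ‖primePowerTerm c α p (k + 2)‖
      = ‖powerSum c p (k + 2)‖
        / (((k + 2 : ℕ) : ℝ) * ((p : ℕ) : ℝ) ^ (((k + 2 : ℕ) : ℝ) * α)) := by
    unfold primePowerTerm
    rw [norm_div, norm_mul, Complex.norm_real, Complex.norm_natCast,
      Real.norm_of_nonneg (by positivity)]
  show ‖primePowerTerm c α p (k + 2)‖ ≤ (m : ℝ) * (p : ℝ) ^ (-(2 * α)) * ((2 : ℝ) ^ (-α)) ^ k
  rw [hnorm, Real.rpow_neg hp0.le, Real.rpow_neg (by norm_num), inv_pow, mul_assoc, ← mul_inv,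
    ← div_eq_mul_inv]
  exact div_le_div₀ (by positivity) hd (by positivity) hden

end GeneralL

/-!
The argument is a quantitative version of Newman's contour proof of his Tauberian theorem.

Write `ℓ = log N` and `y = ℓ ^ (14 / δ)`. The region `D_{δ,N}` is star-shaped about `2`, so the
zero-free function `L` has a holomorphic logarithm near it (`exists_isLogOf`). Subtracting the
contribution of the proper prime powers (`remainderSum`), which is holomorphic and bounded in
`Re s ≥ σ > 1/2` and equals `C(1)` at `s = 1`, leaves a continuation `P(s)` of the series
`∑ d_p(1) p^(-s)`. The growth hypothesis bounds `Re log L = log |L|` by `O(ℓ)`, and the theorem of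
Borel and Carathéodory turns this into `P(s) = O(ℓ)` slightly inside the region
(`IsLogOf.norm_le`).

It remains to compare `P(1)` with the partial sum over `p ≤ y`. Cauchy's formula is used with the
kernel `y ^ s * (1 / s + s / R ^ 2)`, for `P(1 + s)` on `[-α, R] × [-R, R]` and for the partial sum
on `[-R, R] × [-R, R]` (`norm_sub_partialSum_le`). Both the tail of the series for `Re s = σ > 0` and
the partial sum for `σ < 0` are `O(y ^ (-σ) / |σ|)`, which the kernel turns into an error `O(1 / R)`;
here it suffices to estimate sums over primes by sums over all integers. The left-hand edges for `P`
contribute `O(ℓ / R ^ 2 + ℓ * R * y ^ (-α))`. With `α = 15 δ / 112` and `R = ℓ ^ (3/4)` all of this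
is `O(ℓ ^ (-1/8))`, hence `O(1 / log ℓ)`.
-/

namespace GeneralL

section Contour

open Complex Set intervalIntegral
open scoped Real Interval

/-! ### Cauchy's integral formula on a rectangle -/

theorem log_I_mul {z : ℂ} (hz : 0 < z.re) : log (I * z) = log z + (π / 2 : ℝ) * I := by
  have hz0 : z ≠ 0 := by rintro rfl; simp at hz
  have h := abs_lt.mp (abs_arg_lt_pi_div_two_iff.mpr (Or.inl hz))
  rw [Complex.log_mul I_ne_zero hz0, log_I]
  · push_cast; ring
  · rw [arg_I]; constructor <;> linarith [Real.pi_pos]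

theorem log_neg_I_mul {z : ℂ} (hz : 0 < z.re) : log (-I * z) = log z - (π / 2 : ℝ) * I := by
  have hz0 : z ≠ 0 := by rintro rfl; simp at hz
  have h := abs_lt.mp (abs_arg_lt_pi_div_two_iff.mpr (Or.inl hz))
  rw [Complex.log_mul (by simp) hz0, log_neg_I]
  · push_cast; ring
  · rw [arg_neg_I]; constructor <;> linarith [Real.pi_pos]

/-- The integral of `f` over the boundary of `[a, b] × [-T, T]`, counterclockwise. The order of the
four edges is that of `Complex.integral_boundary_rect_eq_zero_of_differentiableOn`. -/
noncomputable def rectIntegral (f : ℂ → ℂ) (a b T : ℝ) : ℂ :=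
  (∫ x : ℝ in a..b, f (x - T * I)) - (∫ x : ℝ in a..b, f (x + T * I)) +
    I * (∫ t : ℝ in -T..T, f (b + t * I)) - I * (∫ t : ℝ in -T..T, f (a + t * I))

theorem integral_I_div {b : ℝ} (hb : 0 < b) (u v : ℝ) :
    (∫ t : ℝ in u..v, I * (b + t * I : ℂ)⁻¹) = log (b + v * I) - log (b + u * I) := by
  have hre : ∀ t : ℝ, 0 < ((b : ℂ) + t * I).re := fun t => by simpa using hb
  refine integral_eq_sub_of_hasDerivAt (f := fun t : ℝ => log ((b : ℂ) + t * I)) (fun t _ => ?_) ?_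
  · have h1 : HasDerivAt (fun t : ℝ => (b : ℂ) + t * I) (1 * I) t :=
      (((hasDerivAt_id t).ofReal_comp).mul_const I).const_add _
    have := h1.clog_real (Or.inl (hre t))
    simpa [div_eq_mul_inv] using this
  · refine ContinuousOn.intervalIntegrable (Continuous.continuousOn ?_)
    refine continuous_const.mul (Continuous.inv₀ (by fun_prop) fun t h => ?_)
    have := hre t
    rw [h] at this
    simp at this

/-- Each edge, divided by a suitable power of `I`, runs in the half-plane `Re z > 0`, where the
principal logarithm is a primitive of `z⁻¹`; by `log_I_mul` and `log_neg_I_mul` the corner values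
cancel up to four times `π / 2 * I`. -/
theorem rectIntegral_inv {a b T : ℝ} (ha : a < 0) (hb : 0 < b) (hT : 0 < T) :
    rectIntegral (fun s => s⁻¹) a b T = 2 * π * I := by
  have e1 : (∫ x : ℝ in a..b, ((x : ℂ) - T * I)⁻¹) = log (T + b * I) - log (T + a * I) := by
    rw [← integral_I_div hT]
    refine integral_congr fun x _ => ?_
    have : (x : ℂ) - T * I = -I * (T + x * I) := by linear_combination (x : ℂ) * I_sq
    simp only [this, mul_inv, inv_neg, inv_I, neg_neg]
  have e2 : (∫ x : ℝ in a..b, ((x : ℂ) + T * I)⁻¹) = log (T - b * I) - log (T - a * I) := by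
    have h := integral_I_div hT (-b) (-a)
    rw [← intervalIntegral.integral_comp_neg] at h
    have h2 : (∫ x : ℝ in a..b, ((x : ℂ) + T * I)⁻¹)
        = ∫ x : ℝ in a..b, -(I * ((T : ℂ) + ((-x : ℝ) : ℂ) * I)⁻¹) := by
      refine integral_congr fun x _ => ?_
      have : (x : ℂ) + T * I = I * (T + ((-x : ℝ) : ℂ) * I) := by
        push_cast; linear_combination (x : ℂ) * I_sq
      simp only [this, mul_inv, inv_I]; ring
    rw [h2, intervalIntegral.integral_neg, h]
    push_cast
    simp only [neg_mul, sub_eq_add_neg]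
    ring
  have e3 : I * (∫ t : ℝ in -T..T, ((b : ℂ) + t * I)⁻¹) = log (b + T * I) - log (b - T * I) := by
    rw [← intervalIntegral.integral_const_mul, integral_I_div hb]
    push_cast
    simp only [neg_mul, sub_eq_add_neg]
  have e4 : I * (∫ t : ℝ in -T..T, ((a : ℂ) + t * I)⁻¹)
      = log (-a - T * I) - log (-a + T * I) := by
    have h := integral_I_div (neg_pos.mpr ha) (-T) T
    have h2 : I * (∫ t : ℝ in -T..T, ((a : ℂ) + t * I)⁻¹)
        = ∫ t : ℝ in -T..T, -(I * (((-a : ℝ) : ℂ) + ((-t : ℝ) : ℂ) * I)⁻¹) := by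
      rw [← intervalIntegral.integral_const_mul]
      refine integral_congr fun t _ => ?_
      have : (a : ℂ) + t * I = -(((-a : ℝ) : ℂ) + ((-t : ℝ) : ℂ) * I) := by
        push_cast; ring
      simp only [this, inv_neg]; ring
    rw [h2, intervalIntegral.integral_neg,
      intervalIntegral.integral_comp_neg (fun t : ℝ => I * (((-a : ℝ) : ℂ) + (t : ℂ) * I)⁻¹),
      neg_neg, h]
    push_cast
    simp only [neg_mul, sub_eq_add_neg]
    ring
  have l1 : log (T + b * I) = log (b - T * I) + (π / 2 : ℝ) * I := by
    rw [← log_I_mul (by simpa using hb)]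
    congr 1; linear_combination (T : ℂ) * I_sq
  have l2 : log (T - b * I) = log (b + T * I) - (π / 2 : ℝ) * I := by
    rw [← log_neg_I_mul (by simpa using hb)]
    congr 1; linear_combination (T : ℂ) * I_sq
  have l3 : log (T + a * I) = log (-a + T * I) - (π / 2 : ℝ) * I := by
    rw [← log_neg_I_mul (by simpa using ha)]
    congr 1; linear_combination (T : ℂ) * I_sq
  have l4 : log (T - a * I) = log (-a - T * I) + (π / 2 : ℝ) * I := by
    rw [← log_I_mul (by simpa using ha)]
    congr 1; linear_combination (T : ℂ) * I_sq
  unfold rectIntegral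
  rw [e1, e2, e3, e4, l1, l2, l3, l4]
  push_cast
  ring

/-- Cauchy's integral formula for a rectangle and the point `0`. The theorem of Cauchy and Goursat is
applied to the difference quotient `dslope G 0`, which is continuous at `0`. -/
theorem rectIntegral_div_self {G : ℂ → ℂ} {a b T : ℝ} (ha : a < 0) (hb : 0 < b) (hT : 0 < T)
    (hG : DifferentiableOn ℂ G (Icc a b ×ℂ Icc (-T) T)) :
    rectIntegral (fun s => G s / s) a b T = 2 * π * I * G 0 := by
  have hab : a ≤ b := by linarith
  have hTT : -T ≤ T := by linarith
  have hnhds : Icc a b ×ℂ Icc (-T) T ∈ nhds (0 : ℂ) := by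
    rw [← mem_interior_iff_mem_nhds, interior_reProdIm, interior_Icc, interior_Icc]
    simp [mem_reProdIm, ha, hb, hT]
  have hG0 : DifferentiableAt ℂ G 0 := hG.differentiableAt hnhds
  have hcont : ContinuousOn (dslope G 0) (Icc a b ×ℂ Icc (-T) T) :=
    (continuousOn_dslope hnhds).mpr ⟨hG.continuousOn, hG0⟩
  have key := integral_boundary_rect_eq_zero_of_differentiable_on_off_countable (dslope G 0)
    (a - T * I) (b + T * I) {0} (countable_singleton 0)
    (by simpa [uIcc_of_le hab, uIcc_of_le hTT] using hcont)
    (by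
      rintro s ⟨hs, hs0⟩
      simp only [sub_re, ofReal_re, mul_re, I_re, mul_zero, ofReal_im, I_im, mul_one, sub_self,
        sub_zero, add_re, add_zero, sub_im, mul_im, zero_sub, add_im, zero_add, min_eq_left hab,
        max_eq_right hab, min_eq_left hTT, max_eq_right hTT] at hs
      refine (differentiableAt_dslope_of_ne hs0).mpr (hG.differentiableAt ?_)
      rw [← mem_interior_iff_mem_nhds, interior_reProdIm, interior_Icc, interior_Icc]
      exact hs)
  simp only [sub_re, ofReal_re, mul_re, I_re, mul_zero, ofReal_im, I_im, mul_one, sub_self,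
        sub_zero, add_re, add_zero, sub_im, mul_im, zero_sub, add_im, zero_add, smul_eq_mul] at key
  have hsl : ∀ s : ℂ, s ≠ 0 → dslope G 0 s = G s / s - G 0 * s⁻¹ := by
    intro s hs
    rw [dslope_of_ne _ hs, slope_def_field]
    field_simp
    simp
  -- each edge stays inside the rectangle and avoids the origin
  have edge : ∀ (γ : ℝ → ℂ) (u v : ℝ), u ≤ v → Continuous γ →
      (∀ t ∈ Icc u v, γ t ∈ Icc a b ×ℂ Icc (-T) T) → (∀ t, γ t ≠ 0) →
      ∫ t in u..v, dslope G 0 (γ t)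
        = (∫ t in u..v, G (γ t) / γ t) - G 0 * ∫ t in u..v, (γ t)⁻¹ := by
    intro γ u v huv hγ hmem hne
    rw [← intervalIntegral.integral_const_mul, ← intervalIntegral.integral_sub]
    · exact integral_congr fun t _ => hsl _ (hne t)
    · refine ContinuousOn.intervalIntegrable ?_
      rw [uIcc_of_le huv]
      exact ((hG.continuousOn.comp hγ.continuousOn hmem)).div hγ.continuousOn fun t _ => hne t
    · exact ((continuous_const.mul (hγ.inv₀ hne))).intervalIntegrable _ _
  have b1 := edge (fun x : ℝ => (x : ℂ) + ((-T : ℝ) : ℂ) * I) a b hab (by fun_prop)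
    (fun t ht => by simpa [mem_reProdIm, hT.le] using ht)
    (fun t h => by simpa [hT.ne'] using congrArg im h)
  have b2 := edge (fun x : ℝ => (x : ℂ) + T * I) a b hab (by fun_prop)
    (fun t ht => by simpa [mem_reProdIm, hT.le] using ht)
    (fun t h => by simpa [hT.ne'] using congrArg im h)
  have b3 := edge (fun t : ℝ => (b : ℂ) + t * I) (-T) T hTT (by fun_prop)
    (fun t ht => by simpa [mem_reProdIm, hab] using ht)
    (fun t h => by simpa [hb.ne'] using congrArg re h)
  have b4 := edge (fun t : ℝ => (a : ℂ) + t * I) (-T) T hTT (by fun_prop)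
    (fun t ht => by simpa [mem_reProdIm, hab] using ht)
    (fun t h => by simpa [ha.ne] using congrArg re h)
  rw [b1, b2, b3, b4] at key
  have hinv := rectIntegral_inv ha hb hT
  unfold rectIntegral at hinv ⊢
  simp only [ofReal_neg, neg_mul, ← sub_eq_add_neg] at key
  linear_combination key + G 0 * hinv

end Contour

/-! ### Sums of powers -/

theorem sum_rpow_sub_one_le_of_le_one {η : ℝ} (h0 : 0 < η) (h1 : η ≤ 1) (n : ℕ) :
    ∑ i ∈ Finset.range n, ((i + 1 : ℕ) : ℝ) ^ (η - 1) ≤ (n : ℝ) ^ η / η := by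
  induction n with
  | zero => simp [Real.zero_rpow h0.ne']
  | succ n ih =>
    rw [Finset.sum_range_succ]
    have hx : (0 : ℝ) < ((n + 1 : ℕ) : ℝ) := by positivity
    have hb := rpow_one_add_le_one_add_mul_self (s := -(1 / ((n + 1 : ℕ) : ℝ)))
      (by
        rw [neg_le_neg_iff, div_le_one hx]
        push_cast; linarith [n.cast_nonneg (α := ℝ)]) h0.le h1
    have hn : (n : ℝ) = ((n + 1 : ℕ) : ℝ) * (1 + -(1 / ((n + 1 : ℕ) : ℝ))) := by
      field_simp; push_cast; ring
    have hn' : (0:ℝ) ≤ 1 + -(1 / ((n + 1 : ℕ) : ℝ)) := by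
      by_contra h
      have := mul_neg_of_pos_of_neg hx (not_le.mp h)
      rw [← hn] at this
      linarith [n.cast_nonneg (α := ℝ)]
    have h2 : (n : ℝ) ^ η ≤ ((n + 1 : ℕ) : ℝ) ^ η * (1 + η * -(1 / ((n + 1 : ℕ) : ℝ))) := by
      conv_lhs => rw [hn]
      rw [Real.mul_rpow hx.le hn']
      gcongr
    rw [Real.rpow_sub_one hx.ne']
    have h3 : (n : ℝ) ^ η / η ≤ ((n + 1 : ℕ) : ℝ) ^ η * (1 + η * -(1 / ((n + 1 : ℕ) : ℝ))) / η := by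
      gcongr
    have h4 : ((n + 1 : ℕ) : ℝ) ^ η * (1 + η * -(1 / ((n + 1 : ℕ) : ℝ))) / η
      = ((n + 1 : ℕ) : ℝ) ^ η / η - ((n + 1 : ℕ) : ℝ) ^ η / ((n + 1 : ℕ) : ℝ) := by
      field_simp
      ring
    linarith

theorem sum_rpow_sub_one_le_of_one_le {η : ℝ} (h1 : 1 ≤ η) (n : ℕ) :
    ∑ i ∈ Finset.range (n + 1), ((i + 1 : ℕ) : ℝ) ^ (η - 1)
      ≤ ((n + 1 : ℕ) : ℝ) ^ η / η + ((n + 1 : ℕ) : ℝ) ^ (η - 1) := by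
  have h0 : 0 < η := by linarith
  induction n with
  | zero => simp; positivity
  | succ n ih =>
    rw [Finset.sum_range_succ]
    have hx : (0 : ℝ) < ((n + 1 : ℕ) : ℝ) := by positivity
    have hb := one_add_mul_self_le_rpow_one_add (s := 1 / ((n + 1 : ℕ) : ℝ))
      (by have : 0 ≤ 1 / ((n + 1 : ℕ) : ℝ) := by positivity
          linarith) h1
    have hn : ((n + 1 + 1 : ℕ) : ℝ) = ((n + 1 : ℕ) : ℝ) * (1 + 1 / ((n + 1 : ℕ) : ℝ)) := by
      field_simp; push_cast; ring
    have h2 : ((n + 1 : ℕ) : ℝ) ^ η * (1 + η * (1 / ((n + 1 : ℕ) : ℝ)))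
        ≤ ((n + 1 + 1 : ℕ) : ℝ) ^ η := by
      rw [hn, Real.mul_rpow hx.le (by positivity)]
      gcongr
    rw [Real.rpow_sub_one hx.ne'] at ih
    have h3 : ((n + 1 : ℕ) : ℝ) ^ η * (1 + η * (1 / ((n + 1 : ℕ) : ℝ))) / η
        ≤ ((n + 1 + 1 : ℕ) : ℝ) ^ η / η := by gcongr
    have h4 : ((n + 1 : ℕ) : ℝ) ^ η * (1 + η * (1 / ((n + 1 : ℕ) : ℝ))) / η
      = ((n + 1 : ℕ) : ℝ) ^ η / η + ((n + 1 : ℕ) : ℝ) ^ η / ((n + 1 : ℕ) : ℝ) := by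
      field_simp
    linarith

/-- Up to the last term, the sum is at most `∫ x in 0..y, x ^ (η - 1) = y ^ η / η`, whether the
summand is decreasing (`η ≤ 1`) or increasing (`1 ≤ η`). -/
theorem sum_rpow_sub_one_le {η y : ℝ} (h0 : 0 < η) (hy : 1 ≤ y) :
    ∑ i ∈ Finset.range ⌊y⌋₊, ((i + 1 : ℕ) : ℝ) ^ (η - 1) ≤ y ^ η * (1 / η + 1 / y) := by
  have hy0 : 0 < y := by linarith
  have hfl : (⌊y⌋₊ : ℝ) ≤ y := Nat.floor_le hy0.le
  have e : y ^ η * (1 / η + 1 / y) = y ^ η / η + y ^ (η - 1) := by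
    rw [Real.rpow_sub_one hy0.ne']; ring
  rw [e]
  rcases le_total η 1 with h1 | h1
  · have := sum_rpow_sub_one_le_of_le_one h0 h1 ⌊y⌋₊
    have h3 : (⌊y⌋₊ : ℝ) ^ η / η ≤ y ^ η / η := by gcongr
    have : 0 < y ^ (η - 1) := by positivity
    linarith
  · obtain ⟨k, hk⟩ : ∃ k, ⌊y⌋₊ = k + 1 :=
      ⟨⌊y⌋₊ - 1, by have := Nat.floor_pos.mpr hy; omega⟩
    rw [hk] at hfl ⊢
    refine (sum_rpow_sub_one_le_of_one_le h1 k).trans ?_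
    gcongr

theorem sum_rpow_neg_one_sub_le {σ : ℝ} (hσ : 0 < σ) (k n : ℕ) (hk : 0 < k) :
    ∑ i ∈ Finset.range (n + 1), ((i + k : ℕ) : ℝ) ^ (-1 - σ)
      ≤ (k : ℝ) ^ (-1 - σ) + ((k : ℝ) ^ (-σ) - ((n + k : ℕ) : ℝ) ^ (-σ)) / σ := by
  induction n with
  | zero => simp
  | succ n ih =>
    rw [Finset.sum_range_succ]
    set x : ℝ := ((n + 1 + k : ℕ) : ℝ) with hxdef
    have hz : (0 : ℝ) < ((n + k : ℕ) : ℝ) := by have : 0 < n + k := by omega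
                                                exact_mod_cast this
    have hx : (0 : ℝ) < x := by positivity
    have hzx : ((n + k : ℕ) : ℝ) = x * (1 - 1 / x) := by
      rw [mul_sub, mul_one_div_cancel hx.ne', hxdef]; push_cast; ring
    have h1x : 0 < 1 - 1 / x := by
      rw [hzx] at hz; exact (mul_pos_iff_of_pos_left hx).mp hz
    have h1 : x ^ (-σ) * (1 + σ * (1 / x)) ≤ ((n + k : ℕ) : ℝ) ^ (-σ) := by
      rw [hzx, Real.mul_rpow hx.le h1x.le]
      gcongr
      -- `(1 - 1/x)^(-σ) ≥ exp (σ/x) ≥ 1 + σ/x`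
      have : 1 - 1 / x ≤ Real.exp (-(1 / x)) := by
        linarith [Real.add_one_le_exp (-(1 / x))]
      calc 1 + σ * (1 / x) ≤ Real.exp (σ * (1 / x)) := by
            linarith [Real.add_one_le_exp (σ * (1 / x))]
        _ = Real.exp (-(1 / x)) ^ (-σ) := by rw [← Real.exp_mul]; ring_nf
        _ ≤ (1 - 1 / x) ^ (-σ) := Real.rpow_le_rpow_of_nonpos h1x this (by linarith)
    have e : x ^ (-1 - σ) = x ^ (-σ) / x := by
      rw [show -1 - σ = -σ - 1 by ring, Real.rpow_sub_one hx.ne']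
    have h2 : x ^ (-σ) * (1 + σ * (1 / x)) / σ ≤ ((n + k : ℕ) : ℝ) ^ (-σ) / σ := by gcongr
    have h3 : x ^ (-σ) * (1 + σ * (1 / x)) / σ = x ^ (-σ) / σ + x ^ (-σ) / x := by
      field_simp
    rw [e]
    have e1 := sub_div ((k : ℝ) ^ (-σ)) (((n + k : ℕ) : ℝ) ^ (-σ)) σ
    have e2 := sub_div ((k : ℝ) ^ (-σ)) (x ^ (-σ)) σ
    linarith

/-- The sum of `n ^ (-1 - σ)` over any range of integers starting just above `y` is bounded, as for
the corresponding integral, uniformly in its length. -/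
theorem sum_tail_rpow_le {σ y : ℝ} (hσ : 0 < σ) (hy : 1 ≤ y) (n : ℕ) :
    ∑ i ∈ Finset.range n, ((i + (⌊y⌋₊ + 1) : ℕ) : ℝ) ^ (-1 - σ)
      ≤ y ^ (-σ) * (1 / σ + 1 / y) := by
  have hy0 : 0 < y := by linarith
  have hk : y ≤ ((⌊y⌋₊ + 1 : ℕ) : ℝ) := by push_cast; exact (Nat.lt_floor_add_one y).le
  have e : y ^ (-σ) * (1 / σ + 1 / y) = y ^ (-σ) / σ + y ^ (-1 - σ) := by
    rw [show -1 - σ = -σ - 1 by ring, Real.rpow_sub_one hy0.ne']; ring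
  have h1 : ∑ i ∈ Finset.range n, ((i + (⌊y⌋₊ + 1) : ℕ) : ℝ) ^ (-1 - σ)
      ≤ ∑ i ∈ Finset.range (n + 1), ((i + (⌊y⌋₊ + 1) : ℕ) : ℝ) ^ (-1 - σ) := by
    rw [Finset.sum_range_succ]
    exact le_add_of_nonneg_right (by positivity)
  have h2 := sum_rpow_neg_one_sub_le hσ (⌊y⌋₊ + 1) n (by omega)
  have h3 : ((⌊y⌋₊ + 1 : ℕ) : ℝ) ^ (-1 - σ) ≤ y ^ (-1 - σ) :=
    Real.rpow_le_rpow_of_nonpos hy0 hk (by linarith)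
  have h4 : (((⌊y⌋₊ + 1 : ℕ) : ℝ) ^ (-σ) - ((n + (⌊y⌋₊ + 1) : ℕ) : ℝ) ^ (-σ)) / σ
      ≤ y ^ (-σ) / σ := by
    gcongr
    have := Real.rpow_le_rpow_of_nonpos hy0 hk (z := -σ) (by linarith)
    have : 0 ≤ ((n + (⌊y⌋₊ + 1) : ℕ) : ℝ) ^ (-σ) := by positivity
    linarith
  rw [e]
  linarith

section Tauberian

open Complex Set intervalIntegral
open scoped Real Interval

/-! ### Newman's contour estimate -/

/-- Half of a rectangle contour: the edges `[a, b] ± T * I`, oriented as in `rectIntegral`, and the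
vertical edge at abscissa `c`, with a sign `ε` (`1` for a right edge, `-1` for a left edge). -/
noncomputable def threeSides (g : ℂ → ℂ) (a b T c : ℝ) (ε : ℂ) : ℂ :=
  (∫ x : ℝ in a..b, g (x - T * I)) - (∫ x : ℝ in a..b, g (x + T * I)) +
    ε * (I * ∫ t : ℝ in -T..T, g (c + t * I))

theorem norm_threeSides_le {g : ℂ → ℂ} {a b T c C₁ C₂ : ℝ} {ε : ℂ} (hab : a ≤ b) (hT : 0 ≤ T)
    (hε : ‖ε‖ = 1) (h₁ : ∀ x ∈ Ioc a b, ‖g (x - T * I)‖ ≤ C₁ ∧ ‖g (x + T * I)‖ ≤ C₁)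
    (h₂ : ∀ t ∈ Ioc (-T) T, ‖g (c + t * I)‖ ≤ C₂) :
    ‖threeSides g a b T c ε‖ ≤ 2 * C₁ * (b - a) + 2 * C₂ * T := by
  have e1 : ‖∫ x : ℝ in a..b, g (x - T * I)‖ ≤ C₁ * |b - a| :=
    norm_integral_le_of_norm_le_const fun x hx => (h₁ x (by rwa [uIoc_of_le hab] at hx)).1
  have e2 : ‖∫ x : ℝ in a..b, g (x + T * I)‖ ≤ C₁ * |b - a| :=
    norm_integral_le_of_norm_le_const fun x hx => (h₁ x (by rwa [uIoc_of_le hab] at hx)).2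
  have e3 : ‖∫ t : ℝ in -T..T, g (c + t * I)‖ ≤ C₂ * |T - -T| :=
    norm_integral_le_of_norm_le_const fun t ht =>
      h₂ t (by rwa [uIoc_of_le (by linarith)] at ht)
  rw [abs_of_nonneg (by linarith)] at e1 e2 e3
  have e4 : ‖ε * (I * ∫ t : ℝ in -T..T, g (c + t * I))‖ ≤ C₂ * (T - -T) := by
    rwa [norm_mul, norm_mul, hε, norm_I, one_mul, one_mul]
  unfold threeSides
  refine (norm_add_le _ _).trans ?_
  have := norm_sub_le (∫ x : ℝ in a..b, g (x - T * I)) (∫ x : ℝ in a..b, g (x + T * I))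
  linarith

/-- Newman's kernel `y ^ s * (1 + s ^ 2 / R ^ 2)`, to be integrated against `1 / s`. The quadratic
factor is `1` at the pole `s = 0` and vanishes at `± R * I`. -/
noncomputable def newmanKernel (y R : ℝ) (s : ℂ) : ℂ := (y : ℂ) ^ s * (1 + s ^ 2 / R ^ 2)

/-- On the edges `Im s = ± R` the kernel is `O(|Re s|)`, by `s ^ 2 + R ^ 2 = (s - R * I) (s + R * I)`.
-/
theorem norm_newmanKernel_div_horizontal {y R x : ℝ} (hy : 0 < y) (hR : 0 < R) (hx : |x| ≤ R)
    {s : ℂ} (hs : s = x - R * I ∨ s = x + R * I) :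
    ‖newmanKernel y R s / s‖ ≤ y ^ x * (3 * |x| / R ^ 2) := by
  have hre : s.re = x := by rcases hs with rfl | rfl <;> simp
  have him : |s.im| = R := by rcases hs with rfl | rfl <;> simp [abs_of_pos hR]
  have hRs : R ≤ ‖s‖ := him ▸ abs_im_le_norm s
  have hR0 : (R : ℂ) ≠ 0 := by exact_mod_cast hR.ne'
  have hfac : ∃ w : ℂ, ‖w‖ ≤ 3 * R ∧ 1 + s ^ 2 / (R : ℂ) ^ 2 = x * w / R ^ 2 := by
    have hn : ‖((x : ℂ))‖ ≤ R := by rwa [norm_real]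
    have hn2 : ‖(2 : ℂ) * R * I‖ = 2 * R := by simp [abs_of_pos hR]
    rcases hs with rfl | rfl
    · refine ⟨x - 2 * R * I, (norm_sub_le _ _).trans (by linarith), ?_⟩
      field_simp
      linear_combination (R : ℂ) ^ 2 * I_sq
    · refine ⟨x + 2 * R * I, (norm_add_le _ _).trans (by linarith), ?_⟩
      field_simp
      linear_combination (R : ℂ) ^ 2 * I_sq
  obtain ⟨w, hw, hw2⟩ := hfac
  rw [newmanKernel, hw2, norm_div, norm_mul, norm_cpow_eq_rpow_re_of_pos hy, hre, mul_div_assoc]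
  refine mul_le_mul_of_nonneg_left ?_ (by positivity)
  rw [norm_div, norm_mul, norm_pow, norm_real, norm_real, Real.norm_eq_abs, Real.norm_eq_abs,
    abs_of_pos hR]
  calc |x| * ‖w‖ / R ^ 2 / ‖s‖ ≤ |x| * (3 * R) / R ^ 2 / R := by gcongr
    _ = 3 * |x| / R ^ 2 := by field_simp

theorem norm_newmanKernel_div_vertical {y R : ℝ} (hy : 0 < y) {s : ℂ} (hs : s.re ≠ 0)
    (hx : |s.re| ≤ R) (ht : |s.im| ≤ R) :
    ‖newmanKernel y R s / s‖ ≤ y ^ s.re * (3 / |s.re|) := by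
  have hx0 : 0 < |s.re| := abs_pos.mpr hs
  have hR : 0 < R := hx0.trans_le hx
  have hs0 : s ≠ 0 := by rintro rfl; simp at hs
  have hns : 0 < ‖s‖ := norm_pos_iff.mpr hs0
  have h2 : ‖s‖ ≤ 2 * R := (norm_le_abs_re_add_abs_im s).trans (by linarith)
  rw [newmanKernel, norm_div, norm_mul, norm_cpow_eq_rpow_re_of_pos hy, mul_div_assoc]
  refine mul_le_mul_of_nonneg_left ?_ (by positivity)
  have h3 : ‖1 + s ^ 2 / (R : ℂ) ^ 2‖ ≤ 1 + ‖s‖ ^ 2 / R ^ 2 := by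
    refine (norm_add_le _ _).trans (le_of_eq ?_)
    simp [abs_of_pos hR]
  calc ‖1 + s ^ 2 / (R : ℂ) ^ 2‖ / ‖s‖ ≤ (1 + ‖s‖ ^ 2 / R ^ 2) / ‖s‖ := by gcongr
    _ = 1 / ‖s‖ + ‖s‖ / R ^ 2 := by field_simp
    _ ≤ 1 / |s.re| + 2 * R / R ^ 2 := by gcongr; exact abs_re_le_norm s
    _ = 1 / |s.re| + 2 / R := by field_simp
    _ ≤ 1 / |s.re| + 2 / |s.re| := by gcongr
    _ = 3 / |s.re| := by ring

/-- A function of size `M * y ^ (-σ) * (1 / |σ| + 1 / y)` contributes `O(M / R)` on half of the square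
`[-R, R] × [-R, R]`: the power of `y` cancels that of the kernel, and the zeros of the kernel at
`± R * I` absorb the singularity `1 / |σ|`. -/
theorem norm_threeSides_newman_le {φ : ℂ → ℂ} {M R y a b c : ℝ} {ε : ℂ} (hM : 0 ≤ M)
    (hR : 0 < R) (hRy : R ≤ y) (hab : b - a = R) (hcR : |c| = R) (hε : ‖ε‖ = 1)
    (hI : ∀ x ∈ Ioc a b, |x| ≤ R)
    (hφ : ∀ s : ℂ, s.re ≠ 0 → s.re ∈ Ioc a b ∨ s.re = c →
      ‖φ s‖ ≤ M * (y ^ (-s.re) * (1 / |s.re| + 1 / y))) :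
    ‖threeSides (fun s => φ s * newmanKernel y R s / s) a b R c ε‖ ≤ 24 * M / R := by
  have hy : 0 < y := hR.trans_le hRy
  have hh : ∀ (x : ℝ) (s : ℂ), x ∈ Ioc a b → (s = x - R * I ∨ s = x + R * I) →
      ‖φ s * newmanKernel y R s / s‖ ≤ 6 * M / R ^ 2 := by
    intro x s hx hs
    have hre : s.re = x := by rcases hs with rfl | rfl <;> simp
    have hk := norm_newmanKernel_div_horizontal hy hR (hI x hx) hs
    rw [mul_div_assoc, norm_mul]
    -- `φ` is not controlled on `Re s = 0`, but the kernel vanishes there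
    rcases eq_or_ne x 0 with rfl | hx0
    · have : ‖newmanKernel y R s / s‖ = 0 := le_antisymm (by simpa using hk) (norm_nonneg _)
      rw [this, mul_zero]; positivity
    · have hxp : 0 < |x| := abs_pos.mpr hx0
      have h1 := hφ s (by rwa [hre]) (Or.inl (by rwa [hre]))
      rw [hre] at h1
      have hyy : y ^ (-x) * y ^ x = 1 := by rw [← Real.rpow_add hy]; simp
      calc ‖φ s‖ * ‖newmanKernel y R s / s‖
          ≤ M * (y ^ (-x) * (1 / |x| + 1 / y)) * (y ^ x * (3 * |x| / R ^ 2)) := by gcongr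
        _ = M * (3 * (1 + |x| / y) / R ^ 2) * (y ^ (-x) * y ^ x) := by field_simp
        _ ≤ M * (3 * (1 + 1) / R ^ 2) * 1 := by
            rw [hyy]
            gcongr
            rw [div_le_one hy]; exact (hI x hx).trans hRy
        _ = 6 * M / R ^ 2 := by ring
  have hv : ∀ t ∈ Ioc (-R) R,
      ‖φ (c + t * I) * newmanKernel y R (c + t * I) / (c + t * I)‖ ≤ 6 * M / R ^ 2 := by
    intro t ht
    have hre : ((c : ℂ) + t * I).re = c := by simp
    have him : ((c : ℂ) + t * I).im = t := by simp
    have hc0 : c ≠ 0 := by rintro rfl; simp at hcR; linarith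
    have hk := norm_newmanKernel_div_vertical (y := y) (R := R) hy (s := (c : ℂ) + t * I)
      (by rwa [hre]) (by rw [hre, hcR]) (by rw [him]; exact abs_le.mpr ⟨ht.1.le, ht.2⟩)
    have h1 := hφ (c + t * I) (by rwa [hre]) (Or.inr hre)
    rw [hre, hcR] at h1 hk
    have hyy : y ^ (-c) * y ^ c = 1 := by rw [← Real.rpow_add hy]; simp
    rw [mul_div_assoc, norm_mul]
    calc _ ≤ M * (y ^ (-c) * (1 / R + 1 / y)) * (y ^ c * (3 / R)) := by gcongr
      _ = M * ((1 / R + 1 / y) * (3 / R)) * (y ^ (-c) * y ^ c) := by ring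
      _ ≤ M * ((1 / R + 1 / R) * (3 / R)) * 1 := by rw [hyy]; gcongr
      _ = 6 * M / R ^ 2 := by field_simp; ring
  have := norm_threeSides_le (g := fun s => φ s * newmanKernel y R s / s) (a := a) (b := b)
    (T := R) (c := c) (ε := ε) (by linarith) hR.le hε
    (fun x hx => ⟨hh x _ hx (Or.inl rfl), hh x _ hx (Or.inr rfl)⟩) hv
  rw [hab] at this
  refine this.trans (le_of_eq ?_)
  field_simp
  ring

/-- The contribution of a function bounded by `B` on the left half of a contour that reaches only to
`Re s = -α`. -/
theorem norm_threeSides_strip_le {F : ℂ → ℂ} {B R y α : ℝ} {ε : ℂ} (hα : 0 < α) (hα1 : α ≤ 1)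
    (hR : 1 ≤ R) (hy : 1 ≤ y) (hε : ‖ε‖ = 1)
    (hF : ∀ s ∈ Icc (-α) 0 ×ℂ Icc (-R) R, ‖F s‖ ≤ B) :
    ‖threeSides (fun s => F s * newmanKernel y R s / s) (-α) 0 R (-α) ε‖
      ≤ 6 * B / R ^ 2 + 6 * (R * B * y ^ (-α) / α) := by
  have hR0 : 0 < R := by linarith
  have hy0 : 0 < y := by linarith
  have hB : 0 ≤ B := (norm_nonneg (F 0)).trans (hF 0 (by
    simp [mem_reProdIm, hα.le, hR0.le]))
  have hh : ∀ (x : ℝ) (s : ℂ), x ∈ Ioc (-α) 0 → (s = x - R * I ∨ s = x + R * I) →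
      ‖F s * newmanKernel y R s / s‖ ≤ 3 * B / R ^ 2 := by
    intro x s hx hs
    have habs : |x| ≤ 1 := abs_le.mpr ⟨by linarith [hx.1], by linarith [hx.2]⟩
    have hk := norm_newmanKernel_div_horizontal hy0 hR0 (habs.trans hR) hs
    have hmem : s ∈ Icc (-α) 0 ×ℂ Icc (-R) R := by
      rcases hs with rfl | rfl <;> simp [mem_reProdIm, hx.1.le, hx.2, hR0.le]
    have hy1 : y ^ x ≤ 1 := Real.rpow_le_one_of_one_le_of_nonpos hy hx.2
    rw [mul_div_assoc, norm_mul]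
    calc _ ≤ B * (y ^ x * (3 * |x| / R ^ 2)) := by gcongr; exact hF s hmem
      _ ≤ B * (1 * (3 * 1 / R ^ 2)) := by gcongr
      _ = 3 * B / R ^ 2 := by ring
  have hv : ∀ t ∈ Ioc (-R) R,
      ‖F ((-α : ℝ) + t * I) * newmanKernel y R ((-α : ℝ) + t * I) / ((-α : ℝ) + t * I)‖
        ≤ B * (y ^ (-α) * (3 / α)) := by
    intro t ht
    have hre : (((-α : ℝ) : ℂ) + t * I).re = -α := by simp
    have him : (((-α : ℝ) : ℂ) + t * I).im = t := by simp
    have hk := norm_newmanKernel_div_vertical (y := y) (R := R) hy0 (s := ((-α : ℝ) : ℂ) + t * I)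
      (by rw [hre]; linarith) (by rw [hre, abs_neg, abs_of_pos hα]; linarith)
      (by rw [him]; exact abs_le.mpr ⟨ht.1.le, ht.2⟩)
    rw [hre, abs_neg, abs_of_pos hα] at hk
    rw [mul_div_assoc, norm_mul]
    gcongr
    refine hF _ ?_
    rw [mem_reProdIm, hre, him]
    exact ⟨⟨le_rfl, by linarith⟩, ht.1.le, ht.2⟩
  have := norm_threeSides_le (g := fun s => F s * newmanKernel y R s / s) (a := -α) (b := 0)
    (T := R) (c := -α) (ε := ε) (by linarith) hR0.le hε
    (fun x hx => ⟨hh x _ hx (Or.inl rfl), hh x _ hx (Or.inr rfl)⟩) hv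
  refine this.trans ?_
  have h1 : 2 * (3 * B / R ^ 2) * (0 - -α) ≤ 6 * B / R ^ 2 := by
    have : 0 ≤ 3 * B / R ^ 2 := by positivity
    have e : 6 * B / R ^ 2 = 2 * (3 * B / R ^ 2) := by ring
    rw [e]; nlinarith
  have h2 : 2 * (B * (y ^ (-α) * (3 / α))) * R = 6 * (R * B * y ^ (-α) / α) := by ring
  linarith

theorem rectIntegral_eq_threeSides_add {g : ℂ → ℂ} {a b T : ℝ} (ha : a ≤ 0) (hb : 0 ≤ b)
    (hT : 0 < T) (hg : ContinuousOn g (Icc a b ×ℂ Icc (-T) T \ {0})) :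
    rectIntegral g a b T = threeSides g a 0 T a (-1) + threeSides g 0 b T b 1 := by
  have hi : ∀ γ : ℝ → ℂ, Continuous γ → (∀ t ∈ Icc a b, γ t ∈ Icc a b ×ℂ Icc (-T) T) →
      (∀ t, γ t ≠ 0) → ∀ u ∈ Icc a b, ∀ v ∈ Icc a b,
      IntervalIntegrable (fun t => g (γ t)) MeasureTheory.volume u v := by
    intro γ hγ hm h0 u hu v hv
    refine ContinuousOn.intervalIntegrable ?_
    exact hg.comp hγ.continuousOn fun t ht => ⟨hm t (uIcc_subset_Icc hu hv ht), h0 t⟩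
  have h0 : (0 : ℝ) ∈ Icc a b := ⟨ha, hb⟩
  have hab : a ≤ b := ha.trans hb
  have i1 := hi (fun x : ℝ => (x : ℂ) - T * I) (by fun_prop)
    (fun t ht => by simpa [mem_reProdIm, hT.le] using ht)
    (fun t h => by simpa [hT.ne'] using congrArg im h)
  have i2 := hi (fun x : ℝ => (x : ℂ) + T * I) (by fun_prop)
    (fun t ht => by simpa [mem_reProdIm, hT.le] using ht)
    (fun t h => by simpa [hT.ne'] using congrArg im h)
  unfold rectIntegral threeSides
  rw [← integral_add_adjacent_intervals (i1 a ⟨le_rfl, hab⟩ 0 h0) (i1 0 h0 b ⟨hab, le_rfl⟩),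
    ← integral_add_adjacent_intervals (i2 a ⟨le_rfl, hab⟩ 0 h0) (i2 0 h0 b ⟨hab, le_rfl⟩)]
  ring

theorem threeSides_sub {g₁ g₂ : ℂ → ℂ} {b T : ℝ} {ε : ℂ} (hb : 0 < b)
    (hT : 0 < T) (h₁ : ContinuousOn g₁ (Icc 0 b ×ℂ Icc (-T) T \ {0}))
    (h₂ : ContinuousOn g₂ (Icc 0 b ×ℂ Icc (-T) T \ {0})) :
    threeSides g₁ 0 b T b ε - threeSides g₂ 0 b T b ε
      = threeSides (fun s => g₁ s - g₂ s) 0 b T b ε := by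
  have hi : ∀ g : ℂ → ℂ, ContinuousOn g (Icc 0 b ×ℂ Icc (-T) T \ {0}) →
      ∀ (γ : ℝ → ℂ) (u v : ℝ), u ≤ v → Continuous γ →
      (∀ t ∈ Icc u v, γ t ∈ Icc 0 b ×ℂ Icc (-T) T) →
      (∀ t, γ t ≠ 0) →
      IntervalIntegrable (fun t => g (γ t)) MeasureTheory.volume u v := by
    intro g hg γ u v huv hγ hm h0
    refine ContinuousOn.intervalIntegrable ?_
    rw [uIcc_of_le huv]
    exact hg.comp hγ.continuousOn fun t ht => ⟨hm t ht, h0 t⟩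
  have i1 := fun g hg => hi g hg (fun x : ℝ => (x : ℂ) - T * I) 0 b hb.le (by fun_prop)
    (fun t ht => by simpa [mem_reProdIm, hT.le] using ht)
    (fun t h => by simpa [hT.ne'] using congrArg im h)
  have i2 := fun g hg => hi g hg (fun x : ℝ => (x : ℂ) + T * I) 0 b hb.le (by fun_prop)
    (fun t ht => by simpa [mem_reProdIm, hT.le] using ht)
    (fun t h => by simpa [hT.ne'] using congrArg im h)
  have i3 := fun g hg => hi g hg (fun t : ℝ => (b : ℂ) + t * I) (-T) T (by linarith) (by fun_prop)
    (fun t ht => by simpa [mem_reProdIm, hb.le] using ht)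
    (fun t h => by simpa [hb.ne'] using congrArg re h)
  unfold threeSides
  rw [integral_sub (i1 g₁ h₁) (i1 g₂ h₂), integral_sub (i2 g₁ h₁) (i2 g₂ h₂),
    integral_sub (i3 g₁ h₁) (i3 g₂ h₂)]
  ring

theorem norm_natCast_cpow_neg_one_add {n : ℕ} (hn : 0 < n) (s : ℂ) :
    ‖(n : ℂ) ^ (-(1 + s))‖ = (n : ℝ) ^ (-1 - s.re) := by
  rw [norm_natCast_cpow_of_pos hn]
  congr 1
  simp; ring

/-- A quantitative form of Newman's Tauberian theorem. Let `F(s) = ∑ aₙ n^(-1-s)` with bounded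
coefficients, continued analytically to a neighbourhood of `0`, and let `f` be the partial sum over
`n ≤ y`. Cauchy's formula with Newman's kernel is applied to `F` on `[-α, R] × [-R, R]` and to the
entire function `f` on the square `[-R, R] × [-R, R]`. In the difference, the right-hand edges carry
the tail `F - f` of the series and the left-hand edges of the square carry `f`, both of size
`y ^ (-σ) / |σ|`; only the remaining edges involve the bound `B` for `F`. -/
theorem norm_sub_partialSum_le {a : ℕ → ℂ} {F : ℂ → ℂ} {M B α R y : ℝ} (ha0 : a 0 = 0)
    (hM : ∀ n, ‖a n‖ ≤ M) (hα : 0 < α) (hα1 : α ≤ 1) (hR : 1 ≤ R) (hRy : R ≤ y)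
    (hF : DifferentiableOn ℂ F (Icc (-α) R ×ℂ Icc (-R) R))
    (hsum : ∀ s : ℂ, 0 < s.re → HasSum (fun n : ℕ => a n * (n : ℂ) ^ (-(1 + s))) (F s))
    (hB : ∀ s ∈ Icc (-α) 0 ×ℂ Icc (-R) R, ‖F s‖ ≤ B) :
    ‖F 0 - ∑ n ∈ Finset.range (⌊y⌋₊ + 1), a n / n‖
      ≤ 8 * M / R + B / R ^ 2 + R * B * y ^ (-α) / α := by
  have hR0 : 0 < R := by linarith
  have hy : 1 ≤ y := hR.trans hRy
  have hy0 : 0 < y := by linarith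
  have hyc : (y : ℂ) ≠ 0 := by exact_mod_cast hy0.ne'
  have hM0 : 0 ≤ M := (norm_nonneg _).trans (hM 0)
  set f : ℂ → ℂ := fun s => ∑ n ∈ Finset.range (⌊y⌋₊ + 1), a n * (n : ℂ) ^ (-(1 + s)) with hf
  have hfd : Differentiable ℂ f := by
    refine Differentiable.fun_sum fun n _ => ?_
    rcases Nat.eq_zero_or_pos n with rfl | hn
    · simp [ha0]
    · have : (n : ℂ) ≠ 0 := by exact_mod_cast hn.ne'
      intro s
      exact (((differentiableAt_id.const_add 1).neg).const_cpow (Or.inl this)).const_mul _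
  have hf0 : f 0 = ∑ n ∈ Finset.range (⌊y⌋₊ + 1), a n / n := by
    refine Finset.sum_congr rfl fun n _ => ?_
    simp [cpow_neg_one, div_eq_mul_inv]
  have hkd : Differentiable ℂ (newmanKernel y R) := by
    intro s
    unfold newmanKernel
    exact (differentiableAt_id.const_cpow (Or.inl hyc)).mul (by fun_prop)
  have hk0 : newmanKernel y R 0 = 1 := by simp [newmanKernel]
  set gF : ℂ → ℂ := fun s => F s * newmanKernel y R s / s with hgF
  set gf : ℂ → ℂ := fun s => f s * newmanKernel y R s / s with hgf
  -- Cauchy's formula for `F` and for the partial sum `f`, on rectangles with a common right half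
  have cF := rectIntegral_div_self (G := fun s => F s * newmanKernel y R s) (a := -α) (b := R)
    (T := R) (by linarith) hR0 hR0 (hF.mul hkd.differentiableOn)
  have cf := rectIntegral_div_self (G := fun s => f s * newmanKernel y R s) (a := -R) (b := R)
    (T := R) (by linarith) hR0 hR0 (hfd.mul hkd).differentiableOn
  have contF : ContinuousOn gF (Icc (-α) R ×ℂ Icc (-R) R \ {0}) :=
    ((hF.mul hkd.differentiableOn).continuousOn.mono sdiff_subset).div continuousOn_id
      fun s hs => hs.2
  have contf : ContinuousOn gf (Icc (-R) R ×ℂ Icc (-R) R \ {0}) :=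
    ((hfd.mul hkd).continuous.continuousOn).div continuousOn_id fun s hs => hs.2
  rw [rectIntegral_eq_threeSides_add (by linarith) hR0.le hR0 contF] at cF
  rw [rectIntegral_eq_threeSides_add (by linarith) hR0.le hR0 contf] at cf
  have hsub := threeSides_sub (g₁ := gF) (g₂ := gf) (ε := 1) hR0 hR0
    (contF.mono (sdiff_subset_sdiff_left fun s hs =>
      ⟨⟨by linarith [hs.1.1], hs.1.2⟩, hs.2⟩))
    (contf.mono (sdiff_subset_sdiff_left fun s hs =>
      ⟨⟨by linarith [hs.1.1], hs.1.2⟩, hs.2⟩))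
  have hsub' : (fun s => gF s - gf s) = fun s => (F s - f s) * newmanKernel y R s / s := by
    funext s; simp only [hgF, hgf]; ring
  rw [hsub'] at hsub
  have b1 : ‖threeSides (fun s => (F s - f s) * newmanKernel y R s / s) 0 R R R 1‖
      ≤ 24 * M / R := by
    refine norm_threeSides_newman_le hM0 hR0 hRy (by ring) (abs_of_pos hR0) (by simp)
      (fun x hx => by rw [abs_of_pos hx.1]; exact hx.2) ?_
    intro s _ hs
    have hpos : 0 < s.re := by
      rcases hs with hs | hs
      · exact hs.1
      · rw [hs]; exact hR0
    rw [abs_of_pos hpos]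
    have ht := ((hasSum_nat_add_iff' (⌊y⌋₊ + 1)).mpr (hsum s hpos)).tendsto_sum_nat.norm
    refine le_of_tendsto ht (Filter.Eventually.of_forall fun n => ?_)
    calc _ ≤ ∑ i ∈ Finset.range n, M * ((i + (⌊y⌋₊ + 1) : ℕ) : ℝ) ^ (-1 - s.re) := by
          refine norm_sum_le_of_le _ fun i _ => ?_
          rw [norm_mul, norm_natCast_cpow_neg_one_add (by omega)]
          gcongr
          exact hM _
      _ ≤ _ := by
          rw [← Finset.mul_sum]
          gcongr
          exact sum_tail_rpow_le hpos hy n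
  have b2 : ‖threeSides gf (-R) 0 R (-R) (-1)‖ ≤ 24 * M / R := by
    refine norm_threeSides_newman_le hM0 hR0 hRy (by ring) (by simp [abs_of_pos hR0]) (by simp)
      (fun x hx => abs_le.mpr ⟨hx.1.le, by linarith [hx.2]⟩) ?_
    intro s hs0 hs
    have hneg : s.re < 0 := by
      rcases hs with hs | hs
      · exact lt_of_le_of_ne hs.2 hs0
      · rw [hs]; linarith
    rw [abs_of_neg hneg, hf]
    simp only []
    rw [Finset.sum_range_succ', ha0, zero_mul, add_zero]
    calc _ ≤ ∑ i ∈ Finset.range ⌊y⌋₊, M * ((i + 1 : ℕ) : ℝ) ^ (-s.re - 1) := by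
          refine norm_sum_le_of_le _ fun i _ => ?_
          rw [norm_mul, norm_natCast_cpow_neg_one_add (by omega),
            show -1 - s.re = -s.re - 1 by ring]
          gcongr
          exact hM _
      _ ≤ _ := by
          rw [← Finset.mul_sum]
          gcongr
          exact sum_rpow_sub_one_le (by linarith) hy
  have b3 : ‖threeSides gF (-α) 0 R (-α) (-1)‖ ≤ _ :=
    norm_threeSides_strip_le (ε := -1) hα hα1 hR hy (by simp) hB
  have hmain : 2 * π * I * (F 0 - f 0) = threeSides gF (-α) 0 R (-α) (-1)
      - threeSides gf (-R) 0 R (-R) (-1)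
      + threeSides (fun s => (F s - f s) * newmanKernel y R s / s) 0 R R R 1 := by
    rw [← hsub]
    simp only [hk0, mul_one] at cF cf
    linear_combination cf - cF
  have hnorm : 2 * π * ‖F 0 - f 0‖ ≤ (6 * B / R ^ 2 + 6 * (R * B * y ^ (-α) / α))
      + 24 * M / R + 24 * M / R := by
    have e : ‖2 * π * I * (F 0 - f 0)‖ = 2 * π * ‖F 0 - f 0‖ := by
      simp [abs_of_pos Real.pi_pos]
    rw [← e, hmain]
    refine (norm_add_le _ _).trans (add_le_add ((norm_sub_le _ _).trans (add_le_add b3 b2)) b1)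
  rw [← hf0]
  have hpi := Real.pi_gt_three
  have hn := norm_nonneg (F 0 - f 0)
  have : 6 * ‖F 0 - f 0‖ ≤ 2 * π * ‖F 0 - f 0‖ := by gcongr; linarith
  have e2 : 24 * M / R = 3 * (8 * M / R) := by ring
  have e3 : 6 * B / R ^ 2 = 6 * (B / R ^ 2) := by ring
  linarith

end Tauberian

section LogL

open Complex Set Filter Topology
open scoped Real

variable {m : ℕ} {c : Fin m → ℕ → ℂ}

/-! ### The proper prime powers and the logarithm of `L` -/

/-- The contribution of the prime powers `p ^ ℓ`, `ℓ ≥ 2`, to the logarithm of the Euler factor at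
`p`. -/
noncomputable def localRemainder {m : ℕ} (c : Fin m → ℕ → ℂ) (p : ℕ) (s : ℂ) : ℂ :=
  ∑ j, (-log (1 - c j p * (p : ℂ) ^ (-s)) - c j p * (p : ℂ) ^ (-s))

/-- The contribution of all proper prime powers to `log L(s)`. It is holomorphic and bounded in
`Re s ≥ σ` for each `σ > 1/2`, and equals `C(1)` at `s = 1`. -/
noncomputable def remainderSum {m : ℕ} (c : Fin m → ℕ → ℂ) (s : ℂ) : ℂ :=
  ∑' p : Nat.Primes, localRemainder c p s


theorem norm_param_mul_cpow_le (hc : ∀ j p, p.Prime → ‖c j p‖ ≤ 1) (j : Fin m) (p : Nat.Primes)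
    {σ : ℝ} {s : ℂ} (hs : σ ≤ s.re) :
    ‖c j p * ((p : ℕ) : ℂ) ^ (-s)‖ ≤ ((p : ℕ) : ℝ) ^ (-σ) := by
  have hp1 : (1 : ℝ) ≤ ((p : ℕ) : ℝ) := by exact_mod_cast p.2.one_le
  rw [norm_mul, norm_natCast_cpow_of_pos p.2.pos, neg_re]
  calc _ ≤ 1 * ((p : ℕ) : ℝ) ^ (-s.re) := by gcongr; exact hc j p p.2
    _ ≤ ((p : ℕ) : ℝ) ^ (-σ) := by
      rw [one_mul]; exact Real.rpow_le_rpow_of_exponent_le hp1 (by linarith)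

theorem prime_rpow_neg_le {σ : ℝ} (hσ : 1 / 2 ≤ σ) (p : Nat.Primes) :
    ((p : ℕ) : ℝ) ^ (-σ) ≤ 3 / 4 := by
  have hp : (2 : ℝ) ≤ ((p : ℕ) : ℝ) := by exact_mod_cast p.2.two_le
  calc ((p : ℕ) : ℝ) ^ (-σ) ≤ (2 : ℝ) ^ (-σ) :=
        Real.rpow_le_rpow_of_nonpos (by norm_num) hp (by linarith)
    _ ≤ (2 : ℝ) ^ (-(1 / 2 : ℝ)) := Real.rpow_le_rpow_of_exponent_le (by norm_num) (by linarith)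
    _ ≤ 3 / 4 := by
      rw [Real.rpow_neg (by norm_num), ← Real.sqrt_eq_rpow]
      rw [inv_le_comm₀ (by positivity) (by norm_num)]
      exact Real.le_sqrt_of_sq_le (by norm_num)

theorem norm_param_mul_cpow_lt_one (hc : ∀ j p, p.Prime → ‖c j p‖ ≤ 1) (j : Fin m)
    (p : Nat.Primes) {s : ℂ} (hs : 1 / 2 ≤ s.re) : ‖c j p * ((p : ℕ) : ℂ) ^ (-s)‖ < 1 :=
  ((norm_param_mul_cpow_le hc j p hs).trans (prime_rpow_neg_le le_rfl p)).trans_lt (by norm_num)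

theorem norm_localRemainder_le (hc : ∀ j p, p.Prime → ‖c j p‖ ≤ 1) (p : Nat.Primes)
    {σ : ℝ} (hσ : 1 / 2 ≤ σ) {s : ℂ} (hs : σ ≤ s.re) :
    ‖localRemainder c p s‖ ≤ 2 * m * ((p : ℕ) : ℝ) ^ (-(2 * σ)) := by
  have hterm : ∀ j, ‖-log (1 - c j p * ((p : ℕ) : ℂ) ^ (-s)) - c j p * ((p : ℕ) : ℂ) ^ (-s)‖
      ≤ 2 * ((p : ℕ) : ℝ) ^ (-(2 * σ)) := by
    intro j
    set z := c j p * ((p : ℕ) : ℂ) ^ (-s) with hz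
    have h1 : ‖z‖ ≤ ((p : ℕ) : ℝ) ^ (-σ) := norm_param_mul_cpow_le hc j p hs
    have h2 : ‖z‖ ≤ 3 / 4 := h1.trans (prime_rpow_neg_le hσ p)
    have hb := norm_log_one_add_sub_self_le (z := -z) (by rw [norm_neg]; linarith)
    rw [norm_neg] at hb
    have e : -log (1 - z) - z = -(log (1 + -z) - -z) := by rw [← sub_eq_add_neg]; ring
    rw [e, norm_neg]
    have h3 : (1 - ‖z‖)⁻¹ ≤ 4 := by
      rw [inv_le_comm₀ (by linarith) (by norm_num)]; linarith
    have h4 : ((p : ℕ) : ℝ) ^ (-(2 * σ)) = (((p : ℕ) : ℝ) ^ (-σ)) ^ 2 := by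
      rw [← Real.rpow_mul_natCast (by positivity)]; congr 1; push_cast; ring
    rw [h4]
    calc _ ≤ ‖z‖ ^ 2 * (1 - ‖z‖)⁻¹ / 2 := hb
      _ ≤ (((p : ℕ) : ℝ) ^ (-σ)) ^ 2 * 4 / 2 := by
          have : 0 ≤ (1 - ‖z‖)⁻¹ := inv_nonneg.mpr (by linarith)
          gcongr
      _ = _ := by ring
  calc _ ≤ ∑ _j : Fin m, 2 * ((p : ℕ) : ℝ) ^ (-(2 * σ)) :=
        norm_sum_le_of_le _ fun j _ => hterm j
    _ = _ := by simp; ring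

theorem summable_remainder_bound (m : ℕ) {σ : ℝ} (hσ : 1 / 2 < σ) :
    Summable fun p : Nat.Primes => 2 * (m : ℝ) * ((p : ℕ) : ℝ) ^ (-(2 * σ)) :=
  (Nat.Primes.summable_rpow.mpr (by linarith)).mul_left _

theorem summable_localRemainder (hc : ∀ j p, p.Prime → ‖c j p‖ ≤ 1) {s : ℂ}
    (hs : 1 / 2 < s.re) : Summable fun p : Nat.Primes => localRemainder c p s :=
  Summable.of_norm_bounded (summable_remainder_bound m hs)
    fun p => norm_localRemainder_le hc p hs.le le_rfl

theorem norm_remainderSum_le (hc : ∀ j p, p.Prime → ‖c j p‖ ≤ 1) {σ : ℝ} (hσ : 1 / 2 < σ)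
    {s : ℂ} (hs : σ ≤ s.re) :
    ‖remainderSum c s‖ ≤ ∑' p : Nat.Primes, 2 * (m : ℝ) * ((p : ℕ) : ℝ) ^ (-(2 * σ)) :=
  tsum_of_norm_bounded (summable_remainder_bound m hσ).hasSum
    fun p => norm_localRemainder_le hc p hσ.le hs

theorem differentiableAt_log_one_sub (hc : ∀ j p, p.Prime → ‖c j p‖ ≤ 1) (j : Fin m)
    (p : Nat.Primes) {s : ℂ} (hs : 1 / 2 ≤ s.re) :
    DifferentiableAt ℂ (fun s => log (1 - c j p * ((p : ℕ) : ℂ) ^ (-s))) s := by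
  have hp : ((p : ℕ) : ℂ) ≠ 0 := by exact_mod_cast p.2.ne_zero
  have hd : DifferentiableAt ℂ (fun s : ℂ => ((p : ℕ) : ℂ) ^ (-s)) s :=
    differentiableAt_id.neg.const_cpow (Or.inl hp)
  refine (((hd.const_mul _).const_sub 1)).clog ?_
  rw [sub_eq_add_neg]
  exact mem_slitPlane_of_norm_lt_one (by rw [norm_neg]; exact norm_param_mul_cpow_lt_one hc j p hs)

theorem differentiableOn_remainderSum (hc : ∀ j p, p.Prime → ‖c j p‖ ≤ 1) :
    DifferentiableOn ℂ (remainderSum c) {s | 1 / 2 < s.re} := by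
  intro s hs
  obtain ⟨σ, h1, h2⟩ := exists_between (show (1 / 2 : ℝ) < s.re from hs)
  have hopen : IsOpen {s : ℂ | σ < s.re} := isOpen_lt continuous_const continuous_re
  have := differentiableOn_tsum_of_summable_norm (F := fun (p : Nat.Primes) s => localRemainder c p s)
    (summable_remainder_bound m h1) (U := {s : ℂ | σ < s.re}) (fun p => ?_) hopen
    (fun p w hw => norm_localRemainder_le hc p h1.le (le_of_lt hw))
  · exact (this.differentiableAt (hopen.mem_nhds h2)).differentiableWithinAt
  · intro w hw
    have hp : ((p : ℕ) : ℂ) ≠ 0 := by exact_mod_cast p.2.ne_zero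
    refine DifferentiableAt.differentiableWithinAt ?_
    refine DifferentiableAt.fun_sum fun j _ => ?_
    exact (differentiableAt_log_one_sub hc j p (h1.trans hw).le).neg.sub
      ((differentiableAt_id.neg.const_cpow (Or.inl hp)).const_mul _)

theorem remainderSum_one (hc : ∀ j p, p.Prime → ‖c j p‖ ≤ 1) :
    remainderSum c 1 = higherSum c 1 := by
  refine tsum_congr fun p => ?_
  have hp : ((p : ℕ) : ℂ) ≠ 0 := by exact_mod_cast p.2.ne_zero
  have h : ∀ j, HasSum (fun k : ℕ => (c j p * ((p : ℕ) : ℂ) ^ (-(1 : ℂ))) ^ (k + 2) / ((k + 2 : ℕ) : ℂ))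
      (-log (1 - c j p * ((p : ℕ) : ℂ) ^ (-(1 : ℂ))) - c j p * ((p : ℕ) : ℂ) ^ (-(1 : ℂ))) := by
    intro j
    have := (hasSum_nat_add_iff' 2).mpr (hasSum_taylorSeries_neg_log
      (norm_param_mul_cpow_lt_one hc j p (s := 1) (by norm_num)))
    simpa [Finset.sum_range_succ] using this
  have hs := hasSum_sum (s := Finset.univ) fun j (_ : j ∈ Finset.univ) => h j
  rw [localRemainder, ← hs.tsum_eq]
  refine tsum_congr fun k => ?_
  rw [primePowerTerm, powerSum, Finset.sum_div]
  refine Finset.sum_congr rfl fun j _ => ?_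
  rw [mul_one, Real.rpow_natCast, cpow_neg_one, mul_pow, inv_pow]
  push_cast
  field_simp

/-- For `Re s > 1`, removing the proper prime powers from `log L(s)` leaves the Dirichlet series
`∑ d_p(1) p^(-s)`. -/
theorem IsLogOf.hasSum_primes {L logL : ℂ → ℂ} {δ : ℝ} {N : ℕ}
    (hc : ∀ j p, p.Prime → ‖c j p‖ ≤ 1) (h : IsLogOf c L δ N logL) {s : ℂ} (hs : 1 < s.re) :
    HasSum (fun p : Nat.Primes => powerSum c p 1 * ((p : ℕ) : ℂ) ^ (-s))
      (logL s - remainderSum c s) := by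
  have := (h.hasSum s hs).sub (summable_localRemainder hc (s := s) (by linarith)).hasSum
  convert! this using 2 with p
  rw [localRemainder, powerSum, Finset.sum_mul, ← Finset.sum_neg_distrib,
    ← Finset.sum_sub_distrib]
  exact Finset.sum_congr rfl fun j _ => by ring

theorem norm_neg_sum_log_le (hc : ∀ j p, p.Prime → ‖c j p‖ ≤ 1) (p : Nat.Primes)
    {σ : ℝ} (hσ : 1 / 2 ≤ σ) {s : ℂ} (hs : σ ≤ s.re) :
    ‖-∑ j, log (1 - c j p * ((p : ℕ) : ℂ) ^ (-s))‖ ≤ 3 * m * ((p : ℕ) : ℝ) ^ (-σ) := by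
  have e : -∑ j, log (1 - c j p * ((p : ℕ) : ℂ) ^ (-s))
      = localRemainder c p s + ∑ j, c j p * ((p : ℕ) : ℂ) ^ (-s) := by
    rw [localRemainder, ← Finset.sum_add_distrib, ← Finset.sum_neg_distrib]
    exact Finset.sum_congr rfl fun j _ => by ring
  have h1 := norm_localRemainder_le hc p hσ hs
  have h2 : ‖∑ j, c j p * ((p : ℕ) : ℂ) ^ (-s)‖ ≤ m * ((p : ℕ) : ℝ) ^ (-σ) := by
    calc _ ≤ ∑ _j : Fin m, ((p : ℕ) : ℝ) ^ (-σ) :=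
          norm_sum_le_of_le _ fun j _ => norm_param_mul_cpow_le hc j p hs
      _ = _ := by simp
  have hp1 : (1 : ℝ) ≤ ((p : ℕ) : ℝ) := by exact_mod_cast p.2.one_le
  have h3 : ((p : ℕ) : ℝ) ^ (-(2 * σ)) ≤ ((p : ℕ) : ℝ) ^ (-σ) :=
    Real.rpow_le_rpow_of_exponent_le hp1 (by linarith)
  rw [e]
  calc _ ≤ 2 * m * ((p : ℕ) : ℝ) ^ (-(2 * σ)) + m * ((p : ℕ) : ℝ) ^ (-σ) :=
        norm_add_le_of_le h1 h2
    _ ≤ 2 * m * ((p : ℕ) : ℝ) ^ (-σ) + m * ((p : ℕ) : ℝ) ^ (-σ) := by gcongr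
    _ = _ := by ring

theorem summable_log_bound (m : ℕ) {σ : ℝ} (hσ : 1 < σ) :
    Summable fun p : Nat.Primes => 3 * (m : ℝ) * ((p : ℕ) : ℝ) ^ (-σ) :=
  (Nat.Primes.summable_rpow.mpr (by linarith)).mul_left _

/-- The logarithm of the Euler product in `Re s > 1`, as a sum of principal logarithms. -/
noncomputable def eulerLog (c : Fin m → ℕ → ℂ) (s : ℂ) : ℂ :=
  ∑' p : Nat.Primes, -∑ j, log (1 - c j p * ((p : ℕ) : ℂ) ^ (-s))

theorem hasSum_eulerLog (hc : ∀ j p, p.Prime → ‖c j p‖ ≤ 1) {s : ℂ} (hs : 1 < s.re) :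
    HasSum (fun p : Nat.Primes => -∑ j, log (1 - c j p * ((p : ℕ) : ℂ) ^ (-s)))
      (eulerLog c s) :=
  (Summable.of_norm_bounded (summable_log_bound m hs)
    fun p => norm_neg_sum_log_le hc p (by linarith) le_rfl).hasSum

theorem norm_eulerLog_le (hc : ∀ j p, p.Prime → ‖c j p‖ ≤ 1) {σ : ℝ} (hσ : 1 < σ) {s : ℂ}
    (hs : σ ≤ s.re) :
    ‖eulerLog c s‖ ≤ ∑' p : Nat.Primes, 3 * (m : ℝ) * ((p : ℕ) : ℝ) ^ (-σ) :=
  tsum_of_norm_bounded (summable_log_bound m hσ).hasSum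
    fun p => norm_neg_sum_log_le hc p (by linarith) hs

theorem differentiableOn_eulerLog (hc : ∀ j p, p.Prime → ‖c j p‖ ≤ 1) :
    DifferentiableOn ℂ (eulerLog c) {s | 1 < s.re} := by
  intro s hs
  obtain ⟨σ, h1, h2⟩ := exists_between (show (1 : ℝ) < s.re from hs)
  have hopen : IsOpen {s : ℂ | σ < s.re} := isOpen_lt continuous_const continuous_re
  have := differentiableOn_tsum_of_summable_norm
    (F := fun (p : Nat.Primes) s => -∑ j, log (1 - c j p * ((p : ℕ) : ℂ) ^ (-s)))
    (summable_log_bound m h1) (U := {s : ℂ | σ < s.re}) (fun p w hw => ?_) hopen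
    (fun p w hw => norm_neg_sum_log_le hc p (by linarith) (le_of_lt hw))
  · exact (this.differentiableAt (hopen.mem_nhds h2)).differentiableWithinAt
  · have hw' : 1 / 2 ≤ w.re := by have : σ < w.re := hw
                                  linarith
    exact (DifferentiableAt.fun_sum fun j _ =>
      differentiableAt_log_one_sub hc j p hw').neg.differentiableWithinAt

theorem exp_eulerLog {L : ℂ → ℂ} (hL : IsEulerProduct c L) {s : ℂ} (hs : 1 < s.re) :
    exp (eulerLog c s) = L s := by
  have h := (hasSum_eulerLog hL.norm_le_one hs).cexp
  refine HasProd.unique ?_ (hL.hasProd s hs)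
  convert! h using 2 with p
  rw [Function.comp_apply, ← Finset.sum_neg_distrib, Complex.exp_sum]
  refine Finset.prod_congr rfl fun j _ => ?_
  rw [Complex.exp_neg, Complex.exp_log]
  intro h0
  have h1 := norm_param_mul_cpow_lt_one hL.norm_le_one j p (s := s) (by linarith)
  rw [← sub_eq_zero.mp h0] at h1
  simp at h1

/-- A zero-free holomorphic function on a star-shaped open set has a holomorphic logarithm. -/
theorem exists_differentiableOn_log {U : Set ℂ} {L : ℂ → ℂ} {z₀ : ℂ} (hU : IsOpen U)
    (hstar : StarConvex ℝ z₀ U) (hne : U.Nonempty) (hL : DifferentiableOn ℂ L U)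
    (hL0 : ∀ s ∈ U, L s ≠ 0) :
    ∃ l : ℂ → ℂ, DifferentiableOn ℂ l U ∧ ∀ s ∈ U, exp (l s) = L s := by
  have hsc : IsSimplyConnected U := by
    have := hstar.contractibleSpace hne
    unfold IsSimplyConnected
    infer_instance
  obtain ⟨l, hl, he⟩ := exists_continuousOn_eqOn_exp_comp hsc hU hL.continuousOn
    (by rintro ⟨s, hs, h⟩; exact hL0 s hs h)
  refine ⟨l, fun s hs => ?_, he⟩
  have hUs : U ∈ 𝓝 s := hU.mem_nhds hs
  have hLs : exp (l s) = L s := he hs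
  have hcont : ContinuousAt l s := hl.continuousAt hUs
  -- near `s` a continuous branch is a translate of the principal logarithm, hence holomorphic
  have hev : ∀ᶠ w in 𝓝 s, l w = l s + log (L w / L s) := by
    have h1 : ∀ᶠ w in 𝓝 s, ‖l w - l s‖ < 1 := by
      have := Metric.continuousAt_iff'.mp hcont 1 one_pos
      simpa only [dist_eq_norm] using this
    filter_upwards [h1, hUs] with w hw hwU
    have hLw : exp (l w) = L w := he hwU
    have him : |(l w - l s).im| < 1 := (abs_im_le_norm _).trans_lt hw
    rw [abs_lt] at him
    rw [← hLw, ← hLs, ← Complex.exp_sub, log_exp (by linarith [Real.pi_gt_three])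
      (by linarith [Real.pi_gt_three])]
    ring
  refine DifferentiableAt.differentiableWithinAt ?_
  refine DifferentiableAt.congr_of_eventuallyEq ?_ hev
  refine (((hL.differentiableAt hUs).div_const _).clog ?_).const_add _
  rw [div_self (hL0 s hs)]
  exact one_mem_slitPlane

theorem isOpen_setOf_forall_segment_mem {V : Set ℂ} (hV : IsOpen V) (z₀ : ℂ) :
    IsOpen {s : ℂ | ∀ t ∈ Icc (0 : ℝ) 1, z₀ + t • (s - z₀) ∈ V} := by
  rw [isOpen_iff_eventually]
  intro s hs
  refine isCompact_Icc.eventually_forall_of_forall_eventually fun t ht => ?_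
  have hcont : Continuous fun q : ℂ × ℝ => z₀ + q.2 • (q.1 - z₀) := by fun_prop
  exact hcont.continuousAt.eventually (hV.mem_nhds (hs t ht))

/-- The region is star-shaped about `2`, hence contained in the open star-shaped set `U` of the
points whose segment to `2` stays in the half-plane `Re s > σL` and avoids the zeros of `L`. A
logarithm on `U` is holomorphic at the boundary points of the region too. -/
theorem exists_isLogOf {L : ℂ → ℂ} {δ σL : ℝ} {N : ℕ} (hσ : σL < 1 - δ / 7) (hσ1 : σL < 1)
    (hL : IsEulerProduct c L) (hh : HolomorphicFrom L σL) (hz : ZeroFree L δ N) :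
    ∃ logL, IsLogOf c L δ N logL := by
  set V : Set ℂ := {s | σL < s.re} ∩ L ⁻¹' {0}ᶜ with hV
  have hO : IsOpen {s : ℂ | σL < s.re} := isOpen_lt continuous_const continuous_re
  have hLd : DifferentiableOn ℂ L {s : ℂ | σL < s.re} :=
    hh.differentiableOn.mono fun s (hs : σL < s.re) => hs.le
  have hVo : IsOpen V := hLd.continuousOn.isOpen_inter_preimage hO isOpen_compl_singleton
  set U : Set ℂ := {s : ℂ | ∀ t ∈ Icc (0 : ℝ) 1, (2 : ℂ) + t • (s - 2) ∈ V} with hUdef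
  have hUo : IsOpen U := isOpen_setOf_forall_segment_mem hVo 2
  have hUV : U ⊆ V := fun s hs => by simpa using hs 1 (by simp)
  have hregV : region δ N ⊆ V := by
    intro s hs
    refine ⟨?_, hz s hs⟩
    rcases hs with h | h
    · exact hσ1.trans_le h
    · exact hσ.trans_le h.1
  have hregU : region δ N ⊆ U := by
    intro s hs t ht
    apply hregV
    have hre : ((2 : ℂ) + t • (s - 2)).re = 2 + t * (s.re - 2) := by simp
    have him : ((2 : ℂ) + t • (s - 2)).im = t * s.im := by simp
    by_cases h1 : 1 ≤ ((2 : ℂ) + t • (s - 2)).re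
    · exact Or.inl h1
    · rw [not_le, hre] at h1
      have hs1 : s.re < 1 := by
        by_contra hcon
        nlinarith [ht.1, ht.2]
      rcases hs with h | ⟨h2, _, h3⟩
      · exact absurd hs1 (not_lt.mpr h)
      · refine Or.inr ⟨?_, by rw [hre]; exact h1, ?_⟩
        · rw [hre]; nlinarith [ht.1, ht.2]
        · rw [him, abs_mul, abs_of_nonneg ht.1]
          exact (mul_le_of_le_one_left (abs_nonneg _) ht.2).trans h3
  have hH : {s : ℂ | 1 < s.re} ⊆ U := fun s (hs : 1 < s.re) => hregU (Or.inl hs.le)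
  have hstar : StarConvex ℝ (2 : ℂ) U := by
    intro s hs a b ha hb hab t ht
    have e : (2 : ℂ) + t • (a • (2 : ℂ) + b • s - 2) = 2 + (t * b) • (s - 2) := by
      have : a = 1 - b := by linarith
      subst this
      simp only [real_smul]; push_cast; ring
    rw [e]
    exact hs _ ⟨mul_nonneg ht.1 hb, mul_le_one₀ ht.2 hb (by linarith)⟩
  have h2H : (2 : ℂ) ∈ {s : ℂ | 1 < s.re} := by simp
  obtain ⟨l, hl, hle⟩ := exists_differentiableOn_log hUo hstar ⟨2, hH h2H⟩
    (hLd.mono fun s hs => (hUV hs).1) fun s hs => (hUV hs).2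
  have hHo : IsOpen {s : ℂ | 1 < s.re} := isOpen_lt continuous_const continuous_re
  have hΛ := differentiableOn_eulerLog hL.norm_le_one
  -- two holomorphic logarithms of `L` differ by a constant on the half-plane `Re s > 1`
  have hconst : ∀ s : ℂ, 1 < s.re → l s - eulerLog c s = l 2 - eulerLog c 2 := by
    intro s hs
    refine hHo.is_const_of_deriv_eq_zero (convex_halfSpace_re_gt 1).isPreconnected
      (f := fun s => l s - eulerLog c s) ((hl.mono hH).sub hΛ) ?_ hs h2H
    intro w hw
    have d1 := (hl.differentiableAt (hUo.mem_nhds (hH hw))).hasDerivAt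
    have d2 := (hΛ.differentiableAt (hHo.mem_nhds hw)).hasDerivAt
    have hev : (fun s => exp (l s)) =ᶠ[𝓝 w] fun s => exp (eulerLog c s) := by
      filter_upwards [hHo.mem_nhds hw] with v hv
      rw [hle v (hH hv), exp_eulerLog hL hv]
    have hd := hev.deriv_eq
    rw [d1.cexp.deriv, d2.cexp.deriv, hev.eq_of_nhds] at hd
    have := mul_left_cancel₀ (Complex.exp_ne_zero _) hd
    exact (d1.sub d2).deriv.trans (by rw [this, sub_self]; rfl)
  refine ⟨fun s => l s - (l 2 - eulerLog c 2), ?_, fun s hs => ?_, fun s hs => ?_⟩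
  · exact ((hl.sub_const _).analyticOnNhd hUo).mono hregU
  · rw [Complex.exp_sub, Complex.exp_sub, hle s (hregU hs), hle 2 (hH h2H), exp_eulerLog hL h2H,
      div_self, div_one]
    exact hz 2 (Or.inl (by simp))
  · have : l s - (l 2 - eulerLog c 2) = eulerLog c s := by rw [← hconst s hs]; ring
    simp only [this]
    exact hasSum_eulerLog hL.norm_le_one hs

/-! ### The size of the logarithm inside the zero-free region -/

theorem two_le_log_of_sixteen_le {N : ℕ} (hN : 16 ≤ N) : 2 ≤ Real.log N := by
  have h1 : Real.log 16 ≤ Real.log N :=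
    Real.log_le_log (by norm_num) (by exact_mod_cast hN)
  have h2 : Real.log 16 = 4 * Real.log 2 := by
    rw [show (16 : ℝ) = 2 ^ 4 by norm_num, Real.log_pow]; norm_num
  linarith [Real.log_two_gt_d9]

theorem log_add_le_self_of_sixteen_le {N : ℕ} (hN : 16 ≤ N) : 5 / 2 + Real.log N ≤ N := by
  have hN' : (16 : ℝ) ≤ N := by exact_mod_cast hN
  have h4 : 4 ≤ √(N : ℝ) := Real.le_sqrt_of_sq_le (by linarith)
  have hsq : √(N : ℝ) ^ 2 = N := Real.sq_sqrt (by linarith)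
  have h1 := Real.log_le_sub_one_of_pos (x := √(N : ℝ)) (by linarith)
  rw [Real.log_sqrt (by linarith)] at h1
  nlinarith

theorem mem_region {δ : ℝ} {N : ℕ} {s : ℂ} (h1 : 1 - δ / 7 ≤ s.re)
    (h2 : |s.im| ≤ 2 * Real.log N ^ 3) : s ∈ region δ N := by
  rcases le_or_gt 1 s.re with h | h
  · exact Or.inl h
  · exact Or.inr ⟨h1, h, h2⟩

theorem norm_le_exp_of_growthBound {L : ℂ → ℂ} {N : ℕ} {σL γ₁ γ₂ K : ℝ} (hN : 0 < N)
    (hγ₂ : 0 ≤ γ₂) (hK : 0 < K) (h : GrowthBound L N σL γ₁ γ₂ K) {s : ℂ} (h1 : σL < s.re)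
    (h2 : s.re < 4) (h3 : 1 + |s.im| ≤ N) (hlog : 1 ≤ Real.log N) :
    ‖L s‖ ≤ Real.exp ((|Real.log K| + γ₁ + γ₂) * Real.log N) := by
  have hN0 : (0 : ℝ) < N := by exact_mod_cast hN
  have hKe : K ≤ Real.exp (|Real.log K| * Real.log N) := by
    calc K = Real.exp (Real.log K) := (Real.exp_log hK).symm
      _ ≤ _ := by
        gcongr
        exact (le_abs_self _).trans (le_mul_of_one_le_right (abs_nonneg _) hlog)
  calc ‖L s‖ ≤ K * (N : ℝ) ^ γ₁ * (1 + |s.im|) ^ γ₂ := h s h1 h2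
    _ ≤ Real.exp (|Real.log K| * Real.log N) * (N : ℝ) ^ γ₁ * (N : ℝ) ^ γ₂ := by gcongr
    _ = _ := by
      rw [Real.rpow_def_of_pos hN0, Real.rpow_def_of_pos hN0, ← Real.exp_add, ← Real.exp_add]
      ring_nf

/-- The bound `log L(s) = O(log N)` inside the zero-free region, by the theorem of Borel and
Carathéodory on the disc of centre `2 + i Im s` and radius `1 + δ / 7`, which touches the line
`Re s = 1 - δ / 7` from the right. There `Re log L = log |L|` is `O(log N)` by the growth bound. -/
theorem IsLogOf.norm_le {L logL : ℂ → ℂ} {δ γ₁ γ₂ K σL : ℝ} {N : ℕ} (hN : 16 ≤ N)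
    (hδ : 0 < δ) (hδ' : δ < 7 / 2) (hσ : δ < 7 * (1 - σL)) (hγ₁ : 0 < γ₁) (hγ₂ : 0 < γ₂)
    (hK : 0 < K) (hL : IsEulerProduct c L) (hg : GrowthBound L N σL γ₁ γ₂ K)
    (hlog : IsLogOf c L δ N logL) {s : ℂ} (hs : 1 - 15 * δ / 112 ≤ s.re) (hs1 : s.re ≤ 1)
    (him : |s.im| ≤ Real.log N) :
    ‖logL s‖ ≤ 336 / δ * ((|Real.log K| + γ₁ + γ₂)
      + ∑' p : Nat.Primes, 3 * (m : ℝ) * ((p : ℕ) : ℝ) ^ (-2 : ℝ)) * Real.log N := by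
  set ℓ := Real.log N with hℓ
  set C₀ := |Real.log K| + γ₁ + γ₂ with hC₀
  set E := ∑' p : Nat.Primes, 3 * (m : ℝ) * ((p : ℕ) : ℝ) ^ (-2 : ℝ) with hE
  have hℓ2 : 2 ≤ ℓ := two_le_log_of_sixteen_le hN
  have hC₀0 : 0 < C₀ := by positivity
  have hE0 : 0 ≤ E := tsum_nonneg fun p => by positivity
  have hN52 := log_add_le_self_of_sixteen_le hN
  set z₀ : ℂ := 2 + s.im * I with hz₀
  have hz₀re : z₀.re = 2 := by simp [hz₀]
  have hz₀im : z₀.im = s.im := by simp [hz₀]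
  have hball : ∀ z ∈ Metric.ball (0 : ℂ) (1 + δ / 7),
      1 - δ / 7 < (z₀ + z).re ∧ (z₀ + z).re < 4 ∧ |(z₀ + z).im| ≤ 3 / 2 + ℓ := by
    intro z hz
    rw [mem_ball_zero_iff] at hz
    have h1 := abs_le.mp ((abs_re_le_norm z).trans hz.le)
    have h1' := (neg_abs_le z.re).trans_lt' (neg_lt_neg ((abs_re_le_norm z).trans_lt hz))
    have h2 := (abs_im_le_norm z).trans hz.le
    rw [add_re, add_im, hz₀re, hz₀im]
    refine ⟨by linarith, by linarith [h1.2], ?_⟩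
    have := abs_add_le s.im z.im
    linarith
  have hreg : ∀ z ∈ Metric.ball (0 : ℂ) (1 + δ / 7), z₀ + z ∈ region δ N := fun z hz =>
    mem_region (hball z hz).1.le ((hball z hz).2.2.trans (by nlinarith [sq_nonneg (ℓ - 2)]))
  have hdiff : DifferentiableOn ℂ (fun z => logL (z₀ + z)) (Metric.ball 0 (1 + δ / 7)) := by
    intro z hz
    exact (((hlog.analytic _ (hreg z hz)).differentiableAt).comp z
      (differentiableAt_id.const_add z₀)).differentiableWithinAt
  have hmaps : MapsTo (fun z => logL (z₀ + z)) (Metric.ball 0 (1 + δ / 7))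
      {w | w.re ≤ C₀ * ℓ} := by
    intro z hz
    obtain ⟨b1, b2, b3⟩ := hball z hz
    have h := norm_le_exp_of_growthBound (by omega) hγ₂.le hK hg
      (show σL < (z₀ + z).re by linarith) b2 (by linarith) (by linarith)
    rw [← hlog.exp_eq _ (hreg z hz), Complex.norm_exp, Real.exp_le_exp] at h
    exact h
  have hz : s - z₀ = ((s.re - 2 : ℝ) : ℂ) := by
    apply Complex.ext <;> simp [hz₀]
  have hnz : ‖s - z₀‖ = 2 - s.re := by
    rw [hz, norm_real, Real.norm_eq_abs, abs_of_neg (by linarith)]; ring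
  have hbc := borelCaratheodory (z := s - z₀) (M := C₀ * ℓ) (by positivity) hdiff hmaps
    (by positivity) (by rw [mem_ball_zero_iff, hnz]; linarith)
  simp only [add_sub_cancel, add_zero] at hbc
  have hcenter : ‖logL z₀‖ ≤ E := by
    have hre : (1 : ℝ) < z₀.re := by rw [hz₀re]; norm_num
    rw [(hlog.hasSum z₀ hre).unique (hasSum_eulerLog hL.norm_le_one hre)]
    exact norm_eulerLog_le hL.norm_le_one (by norm_num) hz₀re.ge
  -- the point `s` stays at distance `δ / 112` from the boundary of the disc
  have hgap : δ / 112 ≤ 1 + δ / 7 - ‖s - z₀‖ := by rw [hnz]; linarith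
  have hnz32 : ‖s - z₀‖ ≤ 3 / 2 := by rw [hnz]; linarith
  calc ‖logL s‖ ≤ _ := hbc
    _ ≤ 2 * (C₀ * ℓ) * (3 / 2) / (δ / 112) + E * (3 / 2 + 3 / 2) / (δ / 112) := by
        gcongr
        linarith
    _ = 336 / δ * (C₀ * ℓ + E) := by field_simp; ring
    _ ≤ 336 / δ * (C₀ * ℓ + E * ℓ) := by
        gcongr
        exact le_mul_of_one_le_right hE0 (by linarith)
    _ = _ := by ring

/-- The coefficients `d_p(1)` of the series over primes, extended by zero to all natural numbers. -/
noncomputable def primeCoeff (c : Fin m → ℕ → ℂ) (n : ℕ) : ℂ :=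
  if n.Prime then powerSum c n 1 else 0

theorem norm_primeCoeff_le (hc : ∀ j p, p.Prime → ‖c j p‖ ≤ 1) (n : ℕ) :
    ‖primeCoeff c n‖ ≤ m := by
  unfold primeCoeff
  split_ifs with hn
  · calc ‖∑ j, c j n ^ 1‖ ≤ ∑ _j : Fin m, (1 : ℝ) :=
          norm_sum_le_of_le _ fun j _ => by rw [pow_one]; exact hc j n hn
      _ = m := by simp
  · simp

theorem sum_primeCoeff_div (c : Fin m → ℕ → ℂ) (k : ℕ) :
    ∑ n ∈ Finset.range (k + 1), primeCoeff c n / n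
      = ∑ p ∈ Finset.Icc 1 k with p.Prime, powerSum c p 1 / (p : ℂ) := by
  rw [Finset.sum_filter]
  symm
  calc _ = ∑ n ∈ Finset.Icc 1 k, primeCoeff c n / n := by
        refine Finset.sum_congr rfl fun n _ => ?_
        unfold primeCoeff
        split_ifs <;> simp
    _ = _ := by
        refine Finset.sum_subset (fun n hn => ?_) fun n hn hn' => ?_
        · rw [Finset.mem_Icc] at hn; rw [Finset.mem_range]; omega
        · have : n = 0 := by
            rw [Finset.mem_Icc] at hn'; rw [Finset.mem_range] at hn; omega
          simp [this]

theorem IsLogOf.hasSum_primeCoeff {L logL : ℂ → ℂ} {δ : ℝ} {N : ℕ}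
    (hc : ∀ j p, p.Prime → ‖c j p‖ ≤ 1) (h : IsLogOf c L δ N logL) {s : ℂ} (hs : 1 < s.re) :
    HasSum (fun n : ℕ => primeCoeff c n * (n : ℂ) ^ (-s)) (logL s - remainderSum c s) := by
  have h1 := h.hasSum_primes hc hs
  have h2 := (hasSum_subtype_iff_indicator (s := {p : ℕ | p.Prime})
    (f := fun p : ℕ => powerSum c p 1 * (p : ℂ) ^ (-s))).mp h1
  convert! h2 using 2 with n
  simp only [primeCoeff, indicator, mem_ofPred_eq]
  split_ifs <;> simp

end LogL

end GeneralL

theorem theorem2 (m : ℕ) (hm : 1 ≤ m) (γ₁ γ₂ K : ℝ) (hγ₁ : 0 < γ₁) (hγ₂ : 0 < γ₂) (hK : 0 < K)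
    (δ : ℝ) (hδ : 0 < δ) (hδ' : δ < 7 / 2) :
    ∃ A : ℝ, ∀ (N : ℕ) (c : Fin m → ℕ → ℂ) (L : ℂ → ℂ) (σL : ℝ),
      16 ≤ N → 1 / 2 ≤ σL → σL < 1 → δ < 7 * (1 - σL) →
      GeneralL.IsEulerProduct c L →
      GeneralL.HolomorphicFrom L σL →
      GeneralL.ZeroFree L δ N →
      GeneralL.GrowthBound L N σL γ₁ γ₂ K →
      (∃ logL : ℂ → ℂ, GeneralL.IsLogOf c L δ N logL) ∧
      ∀ logL : ℂ → ℂ, GeneralL.IsLogOf c L δ N logL →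
        ‖logL 1 -
            ((∑ p ∈ Finset.Icc 1 ⌊Real.log N ^ (14 / δ)⌋₊ with p.Prime,
                GeneralL.powerSum c p 1 / (p : ℂ)) +
              GeneralL.higherSum c 1)‖
          ≤ A / Real.log (Real.log N) := by
  -- With `ℓ = log N`, `y = ℓ ^ (14 / δ)` and `α` slightly below `δ / 7`, the factor `y ^ (-α)` is
  -- `ℓ ^ (-15/8)`; this beats `ℓ * R` for `R = ℓ ^ (3/4)`, while `R` is still large enough that
  -- `ℓ / R ^ 2` tends to zero.
  set α : ℝ := 15 * δ / 112 with hα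
  set A₁ : ℝ := 336 / δ * ((|Real.log K| + γ₁ + γ₂)
      + ∑' p : Nat.Primes, 3 * (m : ℝ) * ((p : ℕ) : ℝ) ^ (-2 : ℝ))
      + ∑' p : Nat.Primes, 2 * (m : ℝ) * ((p : ℕ) : ℝ) ^ (-(2 * (1 - α))) with hA₁
  refine ⟨8 * (8 * m + A₁ + A₁ / α), ?_⟩
  intro N c L σL hN _ hσ1 hσ hL hh hz hg
  refine ⟨GeneralL.exists_isLogOf (by linarith) hσ1 hL hh hz, fun logL hlog => ?_⟩
  have hc := hL.norm_le_one
  set ℓ := Real.log N with hℓ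
  have hℓ2 : 2 ≤ ℓ := GeneralL.two_le_log_of_sixteen_le hN
  have hℓ0 : 0 < ℓ := by linarith
  have hℓ1 : 1 ≤ ℓ := by linarith
  have hα0 : 0 < α := by positivity
  have hα1 : α < 15 / 32 := by rw [hα]; linarith
  have hrem0 : 0 ≤ ∑' p : Nat.Primes, 2 * (m : ℝ) * ((p : ℕ) : ℝ) ^ (-(2 * (1 - α))) :=
    tsum_nonneg fun p => by positivity
  have hE0 : 0 ≤ ∑' p : Nat.Primes, 3 * (m : ℝ) * ((p : ℕ) : ℝ) ^ (-2 : ℝ) :=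
    tsum_nonneg fun p => by positivity
  have hA₁0 : 0 ≤ A₁ := by positivity
  set R : ℝ := ℓ ^ (3 / 4 : ℝ) with hR
  set y : ℝ := ℓ ^ (14 / δ) with hy
  have hR1 : 1 ≤ R := Real.one_le_rpow hℓ1 (by norm_num)
  have hRℓ : R ≤ ℓ := by
    simpa using Real.rpow_le_rpow_of_exponent_le hℓ1 (show (3 / 4 : ℝ) ≤ 1 by norm_num)
  have hRy : R ≤ y := by
    refine Real.rpow_le_rpow_of_exponent_le hℓ1 ?_
    rw [le_div_iff₀ hδ]; linarith
  have hℓ3 : ℓ ≤ 2 * ℓ ^ 3 := by nlinarith [sq_nonneg (ℓ - 2)]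
  have hreg : ∀ s : ℂ, -α ≤ s.re → |s.im| ≤ R → 1 + s ∈ GeneralL.region δ N := by
    intro s h1 h2
    refine GeneralL.mem_region ?_ ?_
    · simp only [Complex.add_re, Complex.one_re]; linarith
    · simp only [Complex.add_im, Complex.one_im, zero_add]; linarith
  have key := GeneralL.norm_sub_partialSum_le (a := GeneralL.primeCoeff c)
    (F := fun s => logL (1 + s) - GeneralL.remainderSum c (1 + s)) (M := m) (B := A₁ * ℓ)
    (α := α) (R := R) (y := y) (by simp [GeneralL.primeCoeff, Nat.not_prime_zero])
    (GeneralL.norm_primeCoeff_le hc) hα0 (by linarith) hR1 hRy ?_ ?_ ?_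
  · rw [GeneralL.sum_primeCoeff_div, add_zero, GeneralL.remainderSum_one hc] at key
    have hlogpos : 0 < Real.log ℓ := Real.log_pos (by linarith)
    have hrate : ℓ ^ (-(1 / 8) : ℝ) ≤ 8 / Real.log ℓ := by
      rw [Real.rpow_neg hℓ0.le, le_div_iff₀ hlogpos, inv_mul_le_iff₀ (by positivity)]
      have := Real.log_le_rpow_div hℓ0.le (show (0 : ℝ) < 1 / 8 by norm_num)
      linarith
    have hmono : ∀ e : ℝ, e ≤ -(1 / 8) → ℓ ^ e ≤ ℓ ^ (-(1 / 8) : ℝ) := fun e he =>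
      Real.rpow_le_rpow_of_exponent_le hℓ1 he
    have t1 : 8 * (m : ℝ) / R = 8 * m * ℓ ^ (-(3 / 4) : ℝ) := by
      rw [Real.rpow_neg hℓ0.le, div_eq_mul_inv]
    have t2 : A₁ * ℓ / R ^ 2 = A₁ * ℓ ^ (-(1 / 2) : ℝ) := by
      have : ℓ / R ^ 2 = ℓ ^ (-(1 / 2) : ℝ) := by
        rw [hR, ← Real.rpow_mul_natCast hℓ0.le, div_eq_iff (by positivity),
          ← Real.rpow_add hℓ0]
        norm_num
      rw [mul_div_assoc, this]
    have t3 : R * (A₁ * ℓ) * y ^ (-α) / α = A₁ / α * ℓ ^ (-(1 / 8) : ℝ) := by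
      have : R * ℓ * y ^ (-α) = ℓ ^ (-(1 / 8) : ℝ) := by
        rw [hR, hy, ← Real.rpow_mul hℓ0.le]
        nth_rewrite 2 [← Real.rpow_one ℓ]
        rw [← Real.rpow_add hℓ0, ← Real.rpow_add hℓ0]
        congr 1
        rw [hα]; field_simp; norm_num
      rw [← this]; ring
    rw [t1, t2, t3] at key
    calc _ = ‖logL 1 - GeneralL.higherSum c 1
          - ∑ p ∈ Finset.Icc 1 ⌊y⌋₊ with p.Prime, GeneralL.powerSum c p 1 / (p : ℂ)‖ := by
          congr 1; ring
      _ ≤ _ := key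
      _ ≤ 8 * m * ℓ ^ (-(1 / 8) : ℝ) + A₁ * ℓ ^ (-(1 / 8) : ℝ)
          + A₁ / α * ℓ ^ (-(1 / 8) : ℝ) := by
          gcongr 8 * m * ?_ + A₁ * ?_ + A₁ / α * _
          · exact hmono _ (by norm_num)
          · exact hmono _ (by norm_num)
      _ = (8 * m + A₁ + A₁ / α) * ℓ ^ (-(1 / 8) : ℝ) := by ring
      _ ≤ (8 * m + A₁ + A₁ / α) * (8 / Real.log ℓ) := by gcongr
      _ = _ := by ring
  · intro s hs
    have h1 : -α ≤ s.re := hs.1.1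
    have hadd : DifferentiableAt ℂ (fun s : ℂ => 1 + s) s := by fun_prop
    have hopen : IsOpen {s : ℂ | 1 / 2 < s.re} := isOpen_lt continuous_const Complex.continuous_re
    refine DifferentiableAt.differentiableWithinAt (DifferentiableAt.sub ?_ ?_)
    · exact (hlog.analytic _ (hreg s h1 (abs_le.mpr hs.2))).differentiableAt.comp s hadd
    · refine ((GeneralL.differentiableOn_remainderSum hc).differentiableAt
        (hopen.mem_nhds ?_)).comp s hadd
      change 1 / 2 < (1 + s).re
      simp only [Complex.add_re, Complex.one_re]; linarith
  · intro s hs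
    exact hlog.hasSum_primeCoeff hc (by simpa using hs)
  · intro s hs
    have h1 : 1 - α ≤ (1 + s).re := by
      simp only [Complex.add_re, Complex.one_re]; linarith [hs.1.1]
    have h2 : (1 + s).re ≤ 1 := by
      simp only [Complex.add_re, Complex.one_re]; linarith [hs.1.2]
    have h3 : |(1 + s).im| ≤ ℓ := by
      simp only [Complex.add_im, Complex.one_im, zero_add]
      exact (abs_le.mpr hs.2).trans hRℓ
    have b1 := hlog.norm_le hN hδ hδ' hσ hγ₁ hγ₂ hK hL hg h1 h2 h3
    have b2 := GeneralL.norm_remainderSum_le hc (by linarith) h1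
    calc _ ≤ _ := norm_sub_le_of_le b1 b2
      _ ≤ _ := by
        rw [hA₁, add_mul]
        gcongr
        exact le_mul_of_one_le_right hrem0 hℓ1
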